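/- Fix $n\ge 1$ and let $Q_0,\dots,Q_n$ be closed unit squares, $Q_j\subset\mathbb R^2$ having lower left corner $(\lceil j/2\rceil,\lfloor j/2\rfloor)$; they form a staircase. Let $\hat S_n$ be the translation surface (with $\omega=dz$) obtained from them by gluing with translations the right edge of $Q_j$ to the left edge of $Q_{r(j)}$ and the top edge of $Q_j$ to the bottom edge of $Q_{u(j)}$. Here $r$ exchanges $2k$ and $2k+1$ whenever $2k+1\le n$ and $u$ exchanges $2k+1$ and $2k+2$ whenever $2k+2\le n$ ($k\ge 0$), and all other indices are fixed. Mark on $\hat S_n$ a single slit $a$: the top edge of $Q_0$, which is glued to the bottom edge of $Q_0$. Let $\Sigma$ be the finite set consisting of the zeros of $\omega$ and the end points of $a$; it is the set of all corners of the squares. A saddle connection is a straight segment of finite positive length on $\hat S_n$ whose end points lie in $\Sigma$ and whose interior avoids $\Sigma$. Let $\Theta(\hat S_n)\subset[0,\pi)$ be the set of all $\theta\in[0,\pi)$ such that the vertical foliation of $e^{i\theta}\omega$ has a saddle connection whose interior is disjoint from the interior of $a$, together with the $\theta$ for which $a$ itself lies in that foliation. For $S\subset\mathbb R$ let $S^*$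 be the set $S$ with its isolated points removed, let $S^{*0}=S$ and $S^{*(m+1)}=(S^{*m})^*$. The Cantor–Bendixson rank of $S$ is the least integer $m\ge 0$ with $S^{*(m+1)}=S^{*m}$ (and $\infty$ if there is none). **Proposition.** For every $n\ge 1$, the Cantor–Bendixson rank of $\Theta(\hat S_n)$ is at least $n+2$. -/

import Mathlib

open scoped Topology

noncomputable section

/-! ## Cantor–Bendixson rank of a set of real numbers -/

/-- The set `S` with all its isolated points removed. -/
def removeIsolated (S : Set ℝ) : Set ℝ := {x ∈ S | AccPt x (Filter.principal S)}

/-- The iterated derived sets: `S` after `m` successive removals of isolated points. -/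
def iteratedDerived (S : Set ℝ) (m : ℕ) : Set ℝ := removeIsolated^[m] S

/-- The Cantor–Bendixson rank: the least `m` at which the sequence of iterated derived sets
stops changing (`⊤` if it changes at every finite step). -/
def cantorBendixsonRank (S : Set ℝ) : ℕ∞ :=
  sInf ((fun m : ℕ => (m : ℕ∞)) '' {m : ℕ | iteratedDerived S (m + 1) = iteratedDerived S m})

/-! ## Square-tiled slit translation surfaces -/

/-- Combinatorial data of a translation surface tiled by unit squares (indexed by `ι`) in which
some horizontal edges of the tiling are slits. The right edge of the square `i` is glued by a
translation to the left edge of `right i`, its top edge to the bottom edge of `up i`.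
The slits are the top edges of the squares `i ∈ slits`. -/
structure SlitSquareTiling (ι : Type) where
  right : Equiv.Perm ι
  up : Equiv.Perm ι
  slits : Set ι

namespace SlitSquareTiling

variable {ι : Type}

/-- The disjoint union of the closed unit squares `[0,1] × [0,1]`, one for every index. -/
abbrev Squares (ι : Type) : Type := (_ : ι) × (unitInterval × unitInterval)

/-- The edge gluings. -/
inductive Glue (T : SlitSquareTiling ι) : Squares ι → Squares ι → Prop
  | right (i : ι) (y : unitInterval) : Glue T ⟨i, (1, y)⟩ ⟨T.right i, (0, y)⟩
  | up (i : ι) (x : unitInterval) : Glue T ⟨i, (x, 1)⟩ ⟨T.up i, (x, 0)⟩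

/-- The surface: the quotient of the disjoint union of the squares by the equivalence relation
generated by the edge gluings. -/
def Surface (T : SlitSquareTiling ι) : Type := Quot T.Glue

/-- The surface carries the quotient topology. -/
instance (T : SlitSquareTiling ι) : TopologicalSpace T.Surface :=
  inferInstanceAs (TopologicalSpace (Quot T.Glue))

/-- The point of the surface with coordinate `z = x + iy` in the square `i`; it is only used for
`0 ≤ x ≤ 1` and `0 ≤ y ≤ 1` (outside this range, coordinates are clamped to `[0,1]`). -/
def point (T : SlitSquareTiling ι) (i : ι) (z : ℂ) : T.Surface :=
  Quot.mk _ ⟨i, (Set.projIcc 0 1 zero_le_one z.re, Set.projIcc 0 1 zero_le_one z.im)⟩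

/-- The set `Σ` of distinguished points (zeros of the differential, marked points and end points
of slits): all the corners of the squares. -/
def distinguished (T : SlitSquareTiling ι) : Set T.Surface :=
  {p | ∃ i : ι, ∃ z : ℂ, (z.re = 0 ∨ z.re = 1) ∧ (z.im = 0 ∨ z.im = 1) ∧ p = T.point i z}

/-- The flat parametrization by `(0,2) × (0,1)` of the square `i` followed, across its right
edge, by the square `right i`; the translation structure is given by `ω = dz`. -/
def unfoldRight (T : SlitSquareTiling ι) (i : ι) (z : ℂ) : T.Surface :=
  if z.re ≤ 1 then T.point i z else T.point (T.right i) (z - 1)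

/-- The flat parametrization by `(0,1) × (0,2)` of the square `i` followed, across its top
edge, by the square `up i`; the translation structure is given by `ω = dz`. -/
def unfoldUp (T : SlitSquareTiling ι) (i : ι) (z : ℂ) : T.Surface :=
  if z.im ≤ 1 then T.point i z else T.point (T.up i) (z - Complex.I)

/-- Near the time `t` the path `γ` runs in the complement of `Σ` and is straight with constant
velocity `v` in a flat coordinate. The flat parametrizations used here cover exactly the
complement of the corners of the squares, and they differ from each other by translations. -/
def IsStraightAt (T : SlitSquareTiling ι) (γ : ℝ → T.Surface) (v : ℂ) (t : ℝ) : Prop :=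
  ∃ i : ι, ∃ w : ℂ,
    (w ∈ Set.Ioo (0 : ℝ) 2 ×ℂ Set.Ioo (0 : ℝ) 1 ∧
      ∀ᶠ s in 𝓝 t, γ s = T.unfoldRight i (w + ((s - t : ℝ) : ℂ) * v)) ∨
    (w ∈ Set.Ioo (0 : ℝ) 1 ×ℂ Set.Ioo (0 : ℝ) 2 ∧
      ∀ᶠ s in 𝓝 t, γ s = T.unfoldUp i (w + ((s - t : ℝ) : ℂ) * v))

/-- `γ`, restricted to `[0,1]`, is a saddle connection with holonomy vector `v`: a straight
segment of finite positive length whose end points lie in `Σ` and whose interior avoids `Σ`. -/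
structure IsSaddleConnection (T : SlitSquareTiling ι) (γ : ℝ → T.Surface) (v : ℂ) : Prop where
  holonomy_ne_zero : v ≠ 0
  continuousOn : ContinuousOn γ (Set.Icc 0 1)
  source_mem : γ 0 ∈ T.distinguished
  target_mem : γ 1 ∈ T.distinguished
  straight : ∀ t ∈ Set.Ioo (0 : ℝ) 1, T.IsStraightAt γ v t

/-- A straight segment with holonomy vector `v` for `ω` lies in a leaf of the vertical foliation
`Re (exp (i θ) ω) = 0` of `exp (i θ) ω`. -/
def IsVerticalAfterRotation (θ : ℝ) (v : ℂ) : Prop :=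
  (Complex.exp (θ * Complex.I) * v).re = 0

/-- The union of the interiors of the slits. -/
def slitInterior (T : SlitSquareTiling ι) : Set T.Surface :=
  {p | ∃ i ∈ T.slits, ∃ x ∈ Set.Ioo (0 : ℝ) 1, p = T.point i (x + Complex.I)}

/-- The set `Θ` of all `θ ∈ [0, π)` such that the vertical foliation of `exp (i θ) ω` has a
saddle connection whose interior is disjoint from the interiors of the slits, or such that
a slit (with holonomy vector `1`, since all the slits are horizontal unit segments) lies in
that foliation. -/
def saddleDirections (T : SlitSquareTiling ι) : Set ℝ :=
  {θ | θ ∈ Set.Ico 0 Real.pi ∧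
    ((∃ (γ : ℝ → T.Surface) (v : ℂ), T.IsSaddleConnection γ v ∧ IsVerticalAfterRotation θ v ∧
        ∀ t ∈ Set.Ioo (0 : ℝ) 1, γ t ∉ T.slitInterior) ∨
      (T.slits.Nonempty ∧ IsVerticalAfterRotation θ 1))}

end SlitSquareTiling

/-! ## The staircase surfaces -/

/-- Swap `2k` and `2k + 1` for all `k` with `2k + 1 ≤ n`; if `n` is even then `n` is fixed. -/
def staircaseRight (n : ℕ) : Equiv.Perm (Fin (n + 1)) :=
  Function.Involutive.toPerm
    (fun j => if j.val % 2 = 0 then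
        (if h : j.val + 1 ≤ n then ⟨j.val + 1, by omega⟩ else j)
      else ⟨j.val - 1, by omega⟩)
    (by
      intro j
      ext
      by_cases h0 : j.val % 2 = 0
      · by_cases h1 : j.val + 1 ≤ n
        · have : (j.val + 1) % 2 ≠ 0 := by omega
          simp [h0, h1, this]
        · simp [h0, h1]
      · have h1 : (j.val - 1) % 2 = 0 := by omega
        have h2 : j.val - 1 + 1 ≤ n := by omega
        simp [h0, h1, h2]
        omega)

/-- Swap `2k + 1` and `2k + 2` for all `k` with `2k + 2 ≤ n`; `0` is fixed, and if `n` is odd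
then `n` is fixed. -/
def staircaseUp (n : ℕ) : Equiv.Perm (Fin (n + 1)) :=
  Function.Involutive.toPerm
    (fun j => if j.val % 2 = 1 then
        (if h : j.val + 1 ≤ n then ⟨j.val + 1, by omega⟩ else j)
      else if j.val = 0 then j else ⟨j.val - 1, by omega⟩)
    (by
      intro j
      ext
      by_cases h0 : j.val % 2 = 1
      · by_cases h1 : j.val + 1 ≤ n
        · have : (j.val + 1) % 2 ≠ 1 := by omega
          simp [h0, h1, this]
        · simp [h0, h1]
      · by_cases h : j.val = 0
        · simp [h]
        · have h1 : (j.val - 1) % 2 = 1 := by omega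
          have h2 : j.val - 1 + 1 ≤ n := by omega
          simp [h0, h, h1, h2]
          omega)

/-- The `n`-th staircase surface, made of `n + 1` unit squares. In the plane the square `j` has
its lower left corner at `(⌈j/2⌉, ⌊j/2⌋)`, so that the squares form a staircase; opposite sides
of every maximal horizontal or vertical strip of squares are glued by translations. The only slit
is the top edge of the square `0`, which is glued to the bottom edge of the same square. For
`n ≥ 2` all corners of the squares are zeros of the differential; for `n = 1` they are the two
end points of the slit on a torus. -/
def staircaseSurface (n : ℕ) : SlitSquareTiling (Fin (n + 1)) where
  right := staircaseRight n
  up := staircaseUp n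
  slits := {0}

end

/-! Describe a non-horizontal segment with holonomy `p + q i` by `x = p / q`, and let `A n` be the
set of these `x` for the saddle connections of the `n`-th staircase that avoid the slit
(`staircaseSlopes`). Away from `π / 2`, an angle `θ` in `Θ` has `tan θ ∈ A n`, and every positive `x
∈ A n` gives `arctan x ∈ Θ`. The angle `π / 2` belongs to `Θ` because the slit is horizontal.

Two moves govern `A n` (`isStaircaseSlopes`). The horizontal cylinders have height 1 and
circumference 1 or 2, so a double Dehn twist preserves the surface and the slit, and `A n` is
invariant under `x ↦ x + 2`. Reflection in the diagonal identifies the `n`-th staircase, cut along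
its slit, with squares `1, …, n + 1` of the next one; the old slit becomes the edge along which
square 0 is attached. Hence `x ↦ x⁻¹` maps nonzero points of `A n` into `A (n + 1)`. Conversely, a
segment steeper than the diagonal cannot visit square 0 of the larger staircase, because the slit is
both its top and its bottom; so the points of `A (n + 1)` with `0 < |x| < 1` are inverses of points
of `A n`. On the single square every segment of height at least 2 crosses the slit, so `A 0`
consists of integers.

By induction, 0 survives `n` derivations of `A n`, being the limit of the points `(2k)⁻¹`. The
derived set of order `n + 1` is empty: translations by 2 reduce to `[-1, 1)`, inversion handles the
interior except 0, and the fixed points `±1` of inversion are isolated. Since `arctan (2k) → π / 2`,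
the derived set of `Θ` of order `n + 1` is exactly `{π / 2}`, which disappears at the next step
(`IsStaircaseSlopes.le_cantorBendixsonRank`).

Geometry and combinatorics are linked by codings, the sequences of squares that segments run
through. The covering of the square torus shows that holonomies are integral. -/

/-! ### Iterated derived sets -/

theorem iteratedDerived_succ (S : Set ℝ) (m : ℕ) :
    iteratedDerived S (m + 1) = removeIsolated (iteratedDerived S m) :=
  Function.iterate_succ_apply' _ _ _

theorem mem_iteratedDerived_succ {S : Set ℝ} {m : ℕ} {x : ℝ} :
    x ∈ iteratedDerived S (m + 1) ↔
      x ∈ iteratedDerived S m ∧ AccPt x (Filter.principal (iteratedDerived S m)) := by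
  rw [iteratedDerived_succ]; rfl

theorem iteratedDerived_antitone (S : Set ℝ) : Antitone (iteratedDerived S) :=
  antitone_nat_of_succ_le fun _ _ hx => (mem_iteratedDerived_succ.1 hx).1

/-- An injective continuous map which sends `S` into `T` sends derived sets into derived sets. -/
theorem mapsTo_iteratedDerived {S T U : Set ℝ} {f : ℝ → ℝ} (hU : IsOpen U)
    (hf : ContinuousOn f U) (hinj : Set.InjOn f U) (hST : Set.MapsTo f (S ∩ U) T) (m : ℕ) :
    Set.MapsTo f (iteratedDerived S m ∩ U) (iteratedDerived T m) := by
  induction m with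
  | zero => exact hST
  | succ m ih =>
    rintro x ⟨hx, hxU⟩
    rw [mem_iteratedDerived_succ] at hx ⊢
    refine ⟨ih ⟨hx.1, hxU⟩, ?_⟩
    have hfx := hf.continuousAt (hU.mem_nhds hxU)
    rw [accPt_iff_nhds]
    intro W hW
    obtain ⟨y, ⟨⟨hyW, hyU⟩, hyS⟩, hyx⟩ := (accPt_iff_nhds.1 hx.2) (f ⁻¹' W ∩ U)
      (Filter.inter_mem (hfx hW) (hU.mem_nhds hxU))
    exact ⟨f y, ⟨hyW, ih ⟨hyS, hyU⟩⟩, fun h => hyx (hinj hyU hxU h)⟩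

/-- The derived sets decrease, so accumulation on the `m`-th one implies accumulation on all earlier
ones, and `x` survives every step. -/
theorem mem_iteratedDerived_of_accPt {S : Set ℝ} {m : ℕ} {x : ℝ} (hx : x ∈ S)
    (h : AccPt x (Filter.principal (iteratedDerived S m))) : x ∈ iteratedDerived S (m + 1) := by
  have key : ∀ k ≤ m + 1, x ∈ iteratedDerived S k := by
    intro k
    induction k with
    | zero => exact fun _ => hx
    | succ k ih =>
      intro hk
      exact mem_iteratedDerived_succ.2 ⟨ih (by omega), h.mono
        (Filter.principal_mono.2 (iteratedDerived_antitone S (by omega)))⟩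
  exact key _ le_rfl

/-- Once two consecutive derived sets agree, the sequence is constant from there on. -/
theorem lt_cantorBendixsonRank {S : Set ℝ} {m : ℕ}
    (h : iteratedDerived S (m + 1) ≠ iteratedDerived S m) :
    ((m + 1 : ℕ) : ℕ∞) ≤ cantorBendixsonRank S := by
  refine le_sInf ?_
  rintro _ ⟨k, hk, rfl⟩
  rw [Set.mem_ofPred_eq] at hk
  beta_reduce
  by_contra hlt
  have hkm : k ≤ m := by
    have : k < m + 1 := by exact_mod_cast not_le.1 hlt
    omega
  have key : ∀ j, iteratedDerived S (k + j) = iteratedDerived S k := by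
    intro j
    induction j with
    | zero => rfl
    | succ j ih => rw [← add_assoc, iteratedDerived_succ, ih, ← iteratedDerived_succ, hk]
  obtain ⟨j, rfl⟩ := Nat.exists_eq_add_of_le hkm
  exact h (by rw [add_assoc, key, key])

/-! ### Sets of slopes that renormalize -/

/-- The properties of the slope sets of the staircases that determine their derived sets. -/
structure IsStaircaseSlopes (A : ℕ → Set ℝ) : Prop where
  int_mem : ∀ (n : ℕ) (m : ℤ), (m : ℝ) ∈ A n
  zero_subset : ∀ x ∈ A 0, ∃ m : ℤ, x = m
  add_two : ∀ (n : ℕ) (e : ℤ), ∀ x ∈ A n, x + 2 * e ∈ A n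
  inv_mem : ∀ n, ∀ x ∈ A n, x ≠ 0 → x⁻¹ ∈ A (n + 1)
  mem_of_inv : ∀ n, ∀ x ∈ A (n + 1), x ≠ 0 → |x| < 1 → x⁻¹ ∈ A n

namespace IsStaircaseSlopes

variable {A : ℕ → Set ℝ} (hA : IsStaircaseSlopes A)
include hA

theorem add_two_mem_iteratedDerived (n m : ℕ) (e : ℤ) {x : ℝ} (hx : x ∈ iteratedDerived (A n) m) :
    x + 2 * e ∈ iteratedDerived (A n) m :=
  mapsTo_iteratedDerived (f := fun x => x + 2 * e) (U := Set.univ) isOpen_univ (by fun_prop)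
    (fun _ _ _ _ h => by simpa using h) (fun y hy => hA.add_two n e y hy.1) m ⟨hx, trivial⟩

/-- The even integers `2k` survive with 0 at level `n`; their inverses survive as often at level `n
+ 1` and accumulate at 0, which gains one derivation. -/
theorem zero_mem_iteratedDerived (n : ℕ) : (0 : ℝ) ∈ iteratedDerived (A n) n := by
  induction n with
  | zero =>
    have := hA.int_mem 0 0
    rwa [Int.cast_zero] at this
  | succ n ih =>
    refine mem_iteratedDerived_of_accPt (by simpa using hA.int_mem (n + 1) 0) ?_
    rw [accPt_iff_nhds]
    intro W hW
    have hlim : Filter.Tendsto (fun k : ℕ => (2 * ((k : ℤ) : ℝ))⁻¹) Filter.atTop (𝓝 0) :=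
      Filter.Tendsto.inv_tendsto_atTop
        ((tendsto_natCast_atTop_atTop.const_mul_atTop two_pos).congr fun k => by simp)
    obtain ⟨k, hkW, hk⟩ := ((hlim.eventually hW).and (Filter.eventually_gt_atTop 0)).exists
    have hpos : (0 : ℝ) < 2 * ((k : ℤ) : ℝ) := by
      have : (0 : ℝ) < k := by exact_mod_cast hk
      simpa using this
    have hmem := hA.add_two_mem_iteratedDerived n n k ih
    rw [zero_add] at hmem
    refine ⟨_, ⟨hkW, ?_⟩, (inv_pos.2 hpos).ne'⟩
    exact mapsTo_iteratedDerived (f := fun x => x⁻¹) (U := Set.Ioi 0) isOpen_Ioi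
      (fun x hx => (continuousAt_inv₀ (ne_of_gt hx)).continuousWithinAt)
      (fun _ _ _ _ h => inv_injective h)
      (fun y hy => hA.inv_mem n y hy.1 (ne_of_gt hy.2)) n ⟨hmem, hpos⟩

/-- Inversion fixes `±1` and translation by 2 exchanges them, so these points never reach the
interior of the fundamental interval and need an induction of their own. -/
theorem isolated_one (n : ℕ) : ∃ ε > 0, ∀ x ∈ A n,
    (|x - 1| < ε → x = 1) ∧ (|x + 1| < ε → x = -1) := by
  induction n with
  | zero =>
    refine ⟨1, one_pos, fun x hx => ?_⟩
    obtain ⟨m, rfl⟩ := hA.zero_subset x hx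
    constructor
    · intro h
      have : |m - 1| < 1 := by exact_mod_cast h
      rw [Int.abs_lt_one_iff] at this
      exact_mod_cast (by omega : m = 1)
    · intro h
      have : |m + 1| < 1 := by exact_mod_cast h
      rw [Int.abs_lt_one_iff] at this
      exact_mod_cast (by omega : m = -1)
  | succ n ih =>
    obtain ⟨ε, hε, h⟩ := ih
    -- The inverse lies outside `[-1, 1]`, at distance `(1 - |x|) / |x| < 2 (1 - |x|)` from `±1`,
    -- which the previous level forbids.
    have inner : ∀ x ∈ A (n + 1), |x| < 1 → 1 / 2 < |x| → (1 - |x|) * 2 < ε → False := by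
      intro x hx h1 h2 h3
      have hx0 : x ≠ 0 := by rintro rfl; norm_num at h2
      have hi := hA.mem_of_inv n x hx hx0 h1
      have hxi : |x|⁻¹ - 1 < ε := by
        have hp : 0 < |x| := by linarith
        rw [show |x|⁻¹ - 1 = (1 - |x|) / |x| by field_simp, div_lt_iff₀ hp]
        nlinarith
      have h1i : 1 < |x|⁻¹ := (one_lt_inv₀ (by linarith)).2 h1
      rcases lt_or_gt_of_ne hx0 with hneg | hpos
      · rw [abs_of_neg hneg, inv_neg] at hxi h1i
        have := (h _ hi).2 (by rw [abs_lt]; constructor <;> linarith)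
        linarith
      · rw [abs_of_pos hpos] at hxi h1i
        have := (h _ hi).1 (by rw [abs_lt]; constructor <;> linarith)
        linarith
    have outer : ∀ x ∈ A (n + 1), |x - 1| < min (1 / 2) (ε / 2) → x = 1 := by
      intro x hx hlt
      rw [lt_min_iff, abs_lt, abs_lt] at hlt
      rcases lt_trichotomy x 1 with hx1 | hx1 | hx1
      · have hxa : |x| = x := abs_of_pos (by linarith)
        exact (inner x hx (by linarith) (by linarith) (by linarith)).elim
      · exact hx1
      -- A point just beyond 1 is translated to a point just inside -1.
      · have hy := hA.add_two (n + 1) (-1) x hx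
        have hya : |x + 2 * ((-1 : ℤ) : ℝ)| = 2 - x := by
          push_cast
          rw [abs_of_neg (by linarith)]; ring
        exact (inner _ hy (by rw [hya]; linarith) (by rw [hya]; linarith)
          (by rw [hya]; linarith)).elim
    refine ⟨min (1 / 2) (ε / 2), by positivity, fun x hx => ⟨outer x hx, fun hlt => ?_⟩⟩
    have := outer _ (hA.add_two (n + 1) 1 x hx) (by push_cast; convert hlt using 2; ring)
    push_cast at this
    linarith

theorem one_notMem_iteratedDerived (n : ℕ) : (1 : ℝ) ∉ iteratedDerived (A n) 1 := by
  intro h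
  obtain ⟨ε, hε, hiso⟩ := hA.isolated_one n
  obtain ⟨y, ⟨hy1, hy2⟩, hy3⟩ :=
    (accPt_iff_nhds.1 (mem_iteratedDerived_succ.1 h).2) _ (Metric.ball_mem_nhds 1 hε)
  exact hy3 ((hiso y hy2).1 (by simpa [Real.dist_eq] using hy1))

theorem iteratedDerived_eq_empty (n : ℕ) : iteratedDerived (A n) (n + 1) = ∅ := by
  rw [Set.eq_empty_iff_forall_notMem]
  induction n with
  | zero =>
    intro x hx
    obtain ⟨hxA, hacc⟩ := mem_iteratedDerived_succ.1 hx
    obtain ⟨m, rfl⟩ := hA.zero_subset x hxA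
    obtain ⟨y, ⟨hy1, hy2⟩, hy3⟩ := (accPt_iff_nhds.1 hacc) _ (Metric.ball_mem_nhds _ one_pos)
    obtain ⟨k, rfl⟩ := hA.zero_subset y hy2
    rw [Metric.mem_ball, Real.dist_eq] at hy1
    have : |k - m| < 1 := by exact_mod_cast hy1
    rw [Int.abs_lt_one_iff] at this
    exact hy3 (by exact_mod_cast (by omega : k = m))
  | succ n ih =>
    have inner : ∀ x ∈ iteratedDerived (A (n + 1)) (n + 1), |x| < 1 → x = 0 := by
      intro x hx hlt
      by_contra hx0
      refine ih x⁻¹ (mapsTo_iteratedDerived (f := fun x => x⁻¹) (S := A (n + 1))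
        (U := {0}ᶜ ∩ Set.Ioo (-1) 1) (isOpen_compl_singleton.inter isOpen_Ioo)
        (fun x hx => (continuousAt_inv₀ hx.1).continuousWithinAt)
        (fun _ _ _ _ h => inv_injective h)
        (fun y hy => hA.mem_of_inv n y hy.1 hy.2.1 (abs_lt.2 hy.2.2)) (n + 1)
        ⟨hx, hx0, abs_lt.1 hlt⟩)
    intro x hx
    -- The representative of `x` modulo 2 in `[-1, 1)`.
    have hy := hA.add_two_mem_iteratedDerived (n + 1) (n + 1 + 1) (-⌊(x + 1) / 2⌋) hx
    set y := x + 2 * ((-⌊(x + 1) / 2⌋ : ℤ) : ℝ) with hydef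
    have hf1 := Int.floor_le ((x + 1) / 2)
    have hf2 := Int.lt_floor_add_one ((x + 1) / 2)
    have hy1 : -1 ≤ y := by rw [hydef]; push_cast; linarith
    have hy2 : y < 1 := by rw [hydef]; push_cast; linarith
    obtain ⟨hym, hacc⟩ := mem_iteratedDerived_succ.1 hy
    rcases hy1.eq_or_lt with h1 | h1
    · have h := hA.add_two_mem_iteratedDerived (n + 1) (n + 1 + 1) 1 hy
      rw [← h1] at h
      norm_num at h
      exact hA.one_notMem_iteratedDerived (n + 1) (iteratedDerived_antitone _ (by omega) h)
    · have hy0 := inner y hym (abs_lt.2 ⟨h1, hy2⟩)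
      obtain ⟨z, ⟨hz1, hz2⟩, hz3⟩ := (accPt_iff_nhds.1 hacc) _ (Metric.ball_mem_nhds _ one_pos)
      rw [hy0] at hz1 hz3
      exact hz3 (inner z hz2 (by simpa [Real.dist_eq] using hz1))

/-- A set of angles which is squeezed between the two preimages of the slope set of level `n`
has Cantor–Bendixson rank at least `n + 2`. -/
theorem le_cantorBendixsonRank (n : ℕ) {S : Set ℝ} (hS : S ⊆ Set.Ico 0 Real.pi)
    (hpi : Real.pi / 2 ∈ S) (htan : ∀ θ ∈ S, θ ≠ Real.pi / 2 → Real.tan θ ∈ A n)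
    (harctan : ∀ x ∈ A n, 0 < x → Real.arctan x ∈ S) :
    ((n + 2 : ℕ) : ℕ∞) ≤ cantorBendixsonRank S := by
  have hpos := Real.pi_pos
  have upper : ∀ θ ∈ iteratedDerived S (n + 1), θ = Real.pi / 2 := by
    intro θ hθ
    by_contra hne
    have hθS : θ ∈ S := iteratedDerived_antitone S (Nat.zero_le _) hθ
    have hθI := hS hθS
    have hempty := hA.iteratedDerived_eq_empty n
    rcases lt_or_gt_of_ne hne with hlt | hgt
    · have := mapsTo_iteratedDerived (f := Real.tan) (S := S) (T := A n)
        (U := Set.Ioo (-(Real.pi / 2)) (Real.pi / 2)) isOpen_Ioo Real.continuousOn_tan_Ioo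
        Real.injOn_tan (fun y hy => htan y hy.1 hy.2.2.ne) (n + 1) ⟨hθ, by linarith [hθI.1], hlt⟩
      rw [hempty] at this
      exact this
    -- Beyond `π / 2` the next branch of the tangent is used.
    · have htan' : ∀ y, Real.tan (y - Real.pi) = Real.tan y := Real.tan_sub_pi
      have := mapsTo_iteratedDerived (f := fun y => Real.tan (y - Real.pi)) (S := S) (T := A n)
        (U := Set.Ioo (Real.pi / 2) (3 * Real.pi / 2)) isOpen_Ioo
        (Real.continuousOn_tan_Ioo.comp (by fun_prop)
          (fun y hy => ⟨by linarith [hy.1], by linarith [hy.2]⟩))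
        (fun y hy z hz h => by
          have := Real.injOn_tan (x₁ := y - Real.pi) (x₂ := z - Real.pi)
            ⟨by linarith [hy.1], by linarith [hy.2]⟩ ⟨by linarith [hz.1], by linarith [hz.2]⟩ h
          linarith)
        (fun y hy => by
          simp only [htan']
          exact htan y hy.1 hy.2.1.ne') (n + 1) ⟨hθ, hgt, by linarith [hθI.2]⟩
      rw [hempty] at this
      exact this
  have lower : Real.pi / 2 ∈ iteratedDerived S (n + 1) := by
    refine mem_iteratedDerived_of_accPt hpi ?_
    rw [accPt_iff_nhds]
    intro W hW
    have hlim : Filter.Tendsto (fun k : ℕ => Real.arctan (2 * ((k : ℤ) : ℝ))) Filter.atTop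
        (𝓝 (Real.pi / 2)) :=
      (Real.tendsto_arctan_atTop.mono_right nhdsWithin_le_nhds).comp
        ((tendsto_natCast_atTop_atTop.const_mul_atTop two_pos).congr fun k => by simp)
    obtain ⟨k, hkW, hk⟩ := ((hlim.eventually hW).and (Filter.eventually_gt_atTop 0)).exists
    have hkpos : (0 : ℝ) < 2 * ((k : ℤ) : ℝ) := by
      have : (0 : ℝ) < k := by exact_mod_cast hk
      simpa using this
    have hmem := hA.add_two_mem_iteratedDerived n n k (hA.zero_mem_iteratedDerived n)
    rw [zero_add] at hmem
    exact ⟨_, ⟨hkW, mapsTo_iteratedDerived (f := Real.arctan) (U := Set.Ioi 0) isOpen_Ioi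
      (Real.continuous_arctan.continuousOn) (Real.arctan_injective.injOn)
      (fun y hy => harctan y hy.1 hy.2) n ⟨hmem, hkpos⟩⟩, (Real.arctan_lt_pi_div_two _).ne⟩
  refine lt_cantorBendixsonRank fun heq => ?_
  rw [← heq] at lower
  obtain ⟨y, ⟨-, hy⟩, hne⟩ := (accPt_iff_nhds.1 (mem_iteratedDerived_succ.1 lower).2) _
    Filter.univ_mem
  exact hne (upper y hy)

end IsStaircaseSlopes

/-! ### Crossing times -/

/-- At the time `t` a motion with velocity `p` which starts at `0` is at an integer. -/
def IsIntTime (p : ℤ) (t : ℝ) : Prop := ∃ m : ℤ, t * p = m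

theorem isIntTime_abs {p : ℤ} {t : ℝ} : IsIntTime |p| t ↔ IsIntTime p t := by
  rcases abs_choice p with h | h
  · rw [h]
  · rw [h]
    constructor
    · rintro ⟨m, hm⟩
      exact ⟨-m, by push_cast at hm ⊢; linarith⟩
    · rintro ⟨m, hm⟩
      exact ⟨-m, by push_cast at hm ⊢; linarith⟩

theorem not_isIntTime_iff {p : ℤ} {t : ℝ} :
    ¬IsIntTime p t ↔ ((⌊t * p⌋ : ℤ) : ℝ) < t * p ∧ t * p < ⌊t * p⌋ + 1 := by
  constructor
  · intro h
    exact ⟨lt_of_le_of_ne (Int.floor_le _) fun h' => h ⟨_, h'.symm⟩, Int.lt_floor_add_one _⟩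
  · rintro ⟨h1, -⟩ ⟨m, hm⟩
    rw [hm, Int.floor_intCast] at h1
    exact lt_irrefl _ h1

theorem not_isIntTime_of_mem {p m : ℤ} {t : ℝ} (h1 : (m : ℝ) < t * p) (h2 : t * p < m + 1) :
    ¬IsIntTime p t := by
  rintro ⟨k, hk⟩
  rw [hk] at h1 h2
  have h1' : m < k := by exact_mod_cast h1
  have h2' : k < m + 1 := by exact_mod_cast h2
  omega

theorem not_isIntTime_one {t : ℝ} (ht : t ∈ Set.Ioo (0 : ℝ) 1) : ¬IsIntTime 1 t :=
  not_isIntTime_of_mem (m := 0) (by simpa using ht.1) (by simpa using ht.2)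

theorem eventually_mul_mem_Ioo {t v a b : ℝ} (ha : a < t * v) (hb : t * v < b) :
    ∀ᶠ s in 𝓝 t, s * v ∈ Set.Ioo a b :=
  (by fun_prop : Continuous fun s : ℝ => s * v).continuousAt.eventually (Ioo_mem_nhds ha hb)

theorem eventually_floor_eq {p : ℤ} {t : ℝ} (h : ¬IsIntTime p t) :
    ∀ᶠ s in 𝓝 t, ⌊s * (p : ℝ)⌋ = ⌊t * (p : ℝ)⌋ := by
  obtain ⟨h1, h2⟩ := not_isIntTime_iff.1 h
  filter_upwards [eventually_mul_mem_Ioo h1 h2] with s hs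
  exact Int.floor_eq_iff.2 ⟨hs.1.le, hs.2⟩

theorem eventually_not_isIntTime {p : ℤ} (hp : p ≠ 0) (t : ℝ) :
    ∀ᶠ s in 𝓝[≠] t, ¬IsIntTime p s := by
  have h1 : ((⌈t * p⌉ : ℤ) : ℝ) - 1 < t * p := by linarith [Int.ceil_lt_add_one (t * (p : ℝ))]
  filter_upwards [eventually_nhdsWithin_of_eventually_nhds
    (eventually_mul_mem_Ioo h1 (Int.lt_floor_add_one _)), self_mem_nhdsWithin] with s hs hne
  rintro ⟨k, hk⟩
  rw [hk] at hs
  have hk1 : ⌈t * (p : ℝ)⌉ - 1 < k := by exact_mod_cast hs.1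
  have hk2 : k < ⌊t * (p : ℝ)⌋ + 1 := by exact_mod_cast hs.2
  have h3 : ((⌈t * p⌉ : ℤ) : ℝ) ≤ k := by exact_mod_cast (by omega : ⌈t * (p : ℝ)⌉ ≤ k)
  have h4 : (k : ℝ) ≤ ⌊t * p⌋ := by exact_mod_cast (by omega : k ≤ ⌊t * (p : ℝ)⌋)
  have h5 := Int.floor_le (t * (p : ℝ))
  have h6 := Int.le_ceil (t * (p : ℝ))
  have h7 : s * p = t * p := by linarith
  exact hne (mul_right_cancel₀ (Int.cast_ne_zero.2 hp) h7)

/-- For the discrete topology on `α` the hypothesis is continuity on a connected set. -/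
theorem eq_of_forall_eventually_eq {α : Type*} {f : ℝ → α} {S : Set ℝ} (hS : S.OrdConnected)
    (h : ∀ x ∈ S, ∀ᶠ y in 𝓝 x, f y = f x) {s t : ℝ} (hs : s ∈ S) (ht : t ∈ S) : f s = f t := by
  let _ : TopologicalSpace α := ⊥
  have _ : DiscreteTopology α := ⟨rfl⟩
  refine hS.isPreconnected.constant (fun x hx => ?_) hs ht
  exact (continuousAt_const.congr ((h x hx).mono fun _ hy => hy.symm)).continuousWithinAt

/-- The function `c` jumps from the value `i` to the value `j` at `t`. -/
def JumpsAt {α : Type*} (c : ℝ → α) (t : ℝ) (i j : α) : Prop :=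
  (∀ᶠ s in 𝓝[<] t, c s = i) ∧ ∀ᶠ s in 𝓝[>] t, c s = j

theorem jumpsAt_of_eventually_eq {α : Type*} {c : ℝ → α} {t : ℝ} {i : α}
    (h : ∀ᶠ s in 𝓝 t, c s = i) : JumpsAt c t i i :=
  ⟨eventually_nhdsWithin_of_eventually_nhds h, eventually_nhdsWithin_of_eventually_nhds h⟩

theorem JumpsAt.map₂ {α β γ : Type*} {c : ℝ → α} {d : ℝ → β} {t : ℝ} {i j : α} {k l : β}
    (hc : JumpsAt c t i j) (hd : JumpsAt d t k l) (f : α → β → γ) :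
    JumpsAt (fun s => f (c s) (d s)) t (f i k) (f j l) := by
  constructor
  · filter_upwards [hc.1, hd.1] with s h1 h2
    rw [h1, h2]
  · filter_upwards [hc.2, hd.2] with s h1 h2
    rw [h1, h2]

theorem JumpsAt.map {α β : Type*} {c : ℝ → α} {t : ℝ} {i j : α}
    (hc : JumpsAt c t i j) (f : α → β) : JumpsAt (fun s => f (c s)) t (f i) (f j) :=
  hc.map₂ hc fun a _ => f a

theorem JumpsAt.forall_of_eventually {α : Type*} {c : ℝ → α} {t : ℝ} {i j : α}
    (hc : JumpsAt c t i j) {P : α → Prop} (h : ∀ᶠ s in 𝓝[≠] t, P (c s)) : P i ∧ P j := by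
  have hl := h.filter_mono (nhdsWithin_mono t fun x (hx : x < t) => hx.ne)
  have hr := h.filter_mono (nhdsWithin_mono t fun x (hx : t < x) => hx.ne')
  obtain ⟨s, h1, h2⟩ := (hc.1.and hl).exists
  obtain ⟨s', h1', h2'⟩ := (hc.2.and hr).exists
  exact ⟨h1 ▸ h2, h1' ▸ h2'⟩

theorem exists_jumpsAt_floor {p : ℤ} (hp : p ≠ 0) {t : ℝ} (h : IsIntTime p t) :
    ∃ a e : ℤ, (e = 1 ∨ e = -1) ∧ JumpsAt (fun s : ℝ => ⌊s * (p : ℝ)⌋) t a (a + e) := by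
  obtain ⟨m, hm⟩ := h
  have hev : ∀ᶠ s in 𝓝 t, s * (p : ℝ) ∈ Set.Ioo ((m : ℝ) - 1) (m + 1) :=
    eventually_mul_mem_Ioo (by linarith) (by linarith)
  rcases lt_or_gt_of_ne hp with hneg | hpos
  · have hp' : (p : ℝ) < 0 := by exact_mod_cast hneg
    refine ⟨m, -1, Or.inr rfl, ?_, ?_⟩
    · filter_upwards [eventually_nhdsWithin_of_eventually_nhds hev, self_mem_nhdsWithin]
        with s hs (hst : s < t)
      exact Int.floor_eq_iff.2 ⟨by nlinarith, hs.2⟩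
    · filter_upwards [eventually_nhdsWithin_of_eventually_nhds hev, self_mem_nhdsWithin]
        with s hs (hst : t < s)
      exact Int.floor_eq_iff.2 ⟨by push_cast; linarith [hs.1], by push_cast; nlinarith⟩
  · have hp' : (0 : ℝ) < p := by exact_mod_cast hpos
    refine ⟨m - 1, 1, Or.inl rfl, ?_, ?_⟩
    · filter_upwards [eventually_nhdsWithin_of_eventually_nhds hev, self_mem_nhdsWithin]
        with s hs (hst : s < t)
      exact Int.floor_eq_iff.2 ⟨by push_cast; linarith [hs.1], by push_cast; nlinarith⟩
    · filter_upwards [eventually_nhdsWithin_of_eventually_nhds hev, self_mem_nhdsWithin]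
        with s hs (hst : t < s)
      exact Int.floor_eq_iff.2 ⟨by push_cast; nlinarith, by push_cast; linarith [hs.2]⟩

/-! ### Codings of segments -/

namespace SlitSquareTiling

variable {ι : Type}

/-- The sequence of squares which a segment with holonomy vector `p + q i` from a corner to a
corner runs through, as a function of the time in `(0,1)`; the segment avoids the corners and the
slits. Its values at the finitely many times of the crossings of edges are irrelevant. -/
structure IsCoding (T : SlitSquareTiling ι) (p q : ℤ) (c : ℝ → ι) : Prop where
  avoids : ∀ t ∈ Set.Ioo (0 : ℝ) 1, IsIntTime p t → ¬IsIntTime q t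
  const : ∀ t ∈ Set.Ioo (0 : ℝ) 1, ¬IsIntTime p t → ¬IsIntTime q t → ∃ i, JumpsAt c t i i
  right : ∀ t ∈ Set.Ioo (0 : ℝ) 1, IsIntTime p t → ∃ i, JumpsAt c t i (T.right i)
  up : ∀ t ∈ Set.Ioo (0 : ℝ) 1, IsIntTime q t → ∃ i ∉ T.slits, JumpsAt c t i (T.up i)

namespace IsCoding

variable {T : SlitSquareTiling ι} {p q : ℤ} {c : ℝ → ι}

/-- A coding records when edges are crossed but not in which direction, so the signs of `p` and `q`
are immaterial. -/
protected theorem abs (h : T.IsCoding p q c) : T.IsCoding |p| |q| c where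
  avoids t ht := by simpa only [isIntTime_abs] using h.avoids t ht
  const t ht := by simpa only [isIntTime_abs] using h.const t ht
  right t ht := by simpa only [isIntTime_abs] using h.right t ht
  up t ht := by simpa only [isIntTime_abs] using h.up t ht

theorem exists_jumpsAt (h : T.IsCoding p q c) {t : ℝ} (ht : t ∈ Set.Ioo (0 : ℝ) 1) :
    ∃ i j, JumpsAt c t i j := by
  by_cases hp : IsIntTime p t
  · obtain ⟨i, hi⟩ := h.right t ht hp
    exact ⟨_, _, hi⟩
  by_cases hq : IsIntTime q t
  · obtain ⟨i, -, hi⟩ := h.up t ht hq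
    exact ⟨_, _, hi⟩
  obtain ⟨i, hi⟩ := h.const t ht hp hq
  exact ⟨_, _, hi⟩

/-- A coding can be changed at the crossing times so as to be continuous from the right. -/
theorem exists_rightContinuous [Nonempty ι] (h : T.IsCoding p q c) :
    ∃ c', T.IsCoding p q c' ∧ ∀ t ∈ Set.Ioo (0 : ℝ) 1, ∀ i j, JumpsAt c' t i j → c' t = j := by
  classical
  -- The limit of `c` from the right, where it exists.
  let c' : ℝ → ι := fun t => Classical.epsilon fun j => ∀ᶠ s in 𝓝[>] t, c s = j
  have hc' : ∀ {t j}, (∀ᶠ s in 𝓝[>] t, c s = j) → c' t = j := by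
    intro t j hj
    have hspec : ∀ᶠ s in 𝓝[>] t, c s = c' t :=
      Classical.epsilon_spec (p := fun j => ∀ᶠ s in 𝓝[>] t, c s = j) ⟨j, hj⟩
    obtain ⟨s, h1, h2⟩ := (hspec.and hj).exists
    exact h1.symm.trans h2
  have key : ∀ {t i j}, JumpsAt c t i j → JumpsAt c' t i j := by
    intro t i j hj
    constructor
    · obtain ⟨l, hl, hsub⟩ := (mem_nhdsLT_iff_exists_Ioo_subset).1 hj.1
      filter_upwards [Ioo_mem_nhdsLT hl] with s hs
      exact hc' (Filter.mem_of_superset (Ioo_mem_nhdsGT hs.2) fun x hx => hsub ⟨hs.1.trans hx.1, hx.2⟩)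
    · obtain ⟨l, hl, hsub⟩ := (mem_nhdsGT_iff_exists_Ioo_subset).1 hj.2
      filter_upwards [Ioo_mem_nhdsGT hl] with s hs
      exact hc' (Filter.mem_of_superset (Ioo_mem_nhdsGT hs.2) fun x hx => hsub ⟨hs.1.trans hx.1, hx.2⟩)
  refine ⟨c', ⟨h.avoids, ?_, ?_, ?_⟩, ?_⟩
  · intro t ht hp hq
    obtain ⟨i, hi⟩ := h.const t ht hp hq
    exact ⟨i, key hi⟩
  · intro t ht hp
    obtain ⟨i, hi⟩ := h.right t ht hp
    exact ⟨i, key hi⟩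
  · intro t ht hp
    obtain ⟨i, hi', hi⟩ := h.up t ht hp
    exact ⟨i, hi', key hi⟩
  · intro t ht i j hj
    obtain ⟨i', j', hj'⟩ := h.exists_jumpsAt ht
    rw [hc' hj'.2]
    obtain ⟨s, h1, h2⟩ := ((key hj').2.and hj.2).exists
    exact h1.symm.trans h2

theorem eventually_eq (h : T.IsCoding p q c)
    (hc : ∀ t ∈ Set.Ioo (0 : ℝ) 1, ∀ i j, JumpsAt c t i j → c t = j) {t : ℝ}
    (ht : t ∈ Set.Ioo (0 : ℝ) 1) (hp : ¬IsIntTime p t) (hq : ¬IsIntTime q t) :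
    ∀ᶠ s in 𝓝 t, c s = c t := by
  obtain ⟨i, hi⟩ := h.const t ht hp hq
  have hci := hc t ht i i hi
  rw [← nhdsNE_sup_pure, Filter.eventually_sup, Filter.eventually_pure,
    punctured_nhds_eq_nhdsWithin_sup_nhdsWithin, Filter.eventually_sup, hci]
  exact ⟨hi, rfl⟩

theorem eq_of_forall_not_isIntTime (h : T.IsCoding p q c)
    (hc : ∀ t ∈ Set.Ioo (0 : ℝ) 1, ∀ i j, JumpsAt c t i j → c t = j) {S : Set ℝ}
    (hS : S.OrdConnected) (hS1 : S ⊆ Set.Ioo 0 1)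
    (hno : ∀ x ∈ S, ¬IsIntTime p x ∧ ¬IsIntTime q x) {s t : ℝ} (hs : s ∈ S) (ht : t ∈ S) :
    c s = c t :=
  _root_.eq_of_forall_eventually_eq hS
    (fun x hx => h.eventually_eq hc (hS1 hx) (hno x hx).1 (hno x hx).2) hs ht

/-- A segment which is steeper than the diagonal cannot run through a square the top edge of which
is a slit glued to its bottom edge. -/
theorem ne_of_lt (h : T.IsCoding p q c)
    (hc : ∀ t ∈ Set.Ioo (0 : ℝ) 1, ∀ i j, JumpsAt c t i j → c t = j) (hp : 0 < p) (hpq : p < q)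
    {k : ι} (hk : k ∈ T.slits) (hup : T.up k = k) {t : ℝ} (ht : t ∈ Set.Ioo (0 : ℝ) 1)
    (htp : ¬IsIntTime p t) (htq : ¬IsIntTime q t) : c t ≠ k := by
  intro hck
  have hp' : (0 : ℝ) < p := by exact_mod_cast hp
  have hq' : (0 : ℝ) < q := by exact_mod_cast hp.trans hpq
  obtain ⟨ha1, ha2⟩ := not_isIntTime_iff.1 htp
  obtain ⟨hb1, hb2⟩ := not_isIntTime_iff.1 htq
  have ha0 : 0 ≤ ⌊t * (p : ℝ)⌋ := Int.floor_nonneg.2 (by nlinarith [ht.1])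
  have hb0 : 0 ≤ ⌊t * (q : ℝ)⌋ := Int.floor_nonneg.2 (by nlinarith [ht.1])
  have hap : ⌊t * (p : ℝ)⌋ < p := Int.floor_lt.2 (by nlinarith [ht.2])
  have hbq : ⌊t * (q : ℝ)⌋ < q := Int.floor_lt.2 (by nlinarith [ht.2])
  generalize ⌊t * (p : ℝ)⌋ = a at *
  generalize ⌊t * (q : ℝ)⌋ = b at *
  -- The segment `(tp, tq)` is in the lattice cell `(a, b)` and meets height `b` at abscissa `bp /
  -- q`. If this is at least `a`, the cell was entered from below, hence through the slit, as `k` is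
  -- glued to itself.
  have no_entry : ¬(1 ≤ b ∧ a * q ≤ b * p) := by
    rintro ⟨hb, hab⟩
    have hab' : (a : ℝ) * q ≤ b * p := by exact_mod_cast hab
    have hbpos : (1 : ℝ) ≤ b := by exact_mod_cast hb
    have ht0t : (b : ℝ) / q < t := (div_lt_iff₀ hq').2 hb1
    have ht0 : (b : ℝ) / q ∈ Set.Ioo (0 : ℝ) 1 := ⟨by positivity, ht0t.trans ht.2⟩
    obtain ⟨i, hi, hj⟩ := h.up _ ht0 ⟨b, div_mul_cancel₀ _ hq'.ne'⟩
    obtain ⟨s, hs1, hs2⟩ := (hj.2.and (Ioo_mem_nhdsGT ht0t)).exists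
    have hst : c s = c t := by
      refine h.eq_of_forall_not_isIntTime hc (S := Set.Icc s t) Set.ordConnected_Icc
        (fun x hx => ⟨ht0.1.trans (hs2.1.trans_le hx.1), hx.2.trans_lt ht.2⟩) (fun x hx => ?_)
        ⟨le_rfl, hs2.2.le⟩ ⟨hs2.2.le, le_rfl⟩
      have hbx : (b : ℝ) < x * q := (div_lt_iff₀ hq').1 (hs2.1.trans_le hx.1)
      refine ⟨not_isIntTime_of_mem (m := a) ?_ (by nlinarith [hx.2]),
        not_isIntTime_of_mem (m := b) hbx (by nlinarith [hx.2])⟩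
      have : (a : ℝ) * q < x * p * q := by nlinarith
      exact lt_of_mul_lt_mul_right this hq'.le
    rw [hs1, hck] at hst
    rw [T.up.injective (hst.trans hup.symm)] at hi
    exact hi hk
  have no_exit : ¬(b + 1 < q ∧ (b + 1) * p ≤ (a + 1) * q) := by
    rintro ⟨hb, hab⟩
    have hab' : ((b : ℝ) + 1) * p ≤ (a + 1) * q := by exact_mod_cast hab
    have hbq' : (b : ℝ) + 1 < q := by exact_mod_cast hb
    have ht0t : t < ((b : ℝ) + 1) / q := (lt_div_iff₀ hq').2 hb2
    have ht0 : ((b : ℝ) + 1) / q ∈ Set.Ioo (0 : ℝ) 1 :=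
      ⟨ht.1.trans ht0t, (div_lt_one hq').2 hbq'⟩
    obtain ⟨i, hi, hj⟩ := h.up _ ht0 ⟨b + 1, by rw [div_mul_cancel₀ _ hq'.ne']; push_cast; rfl⟩
    obtain ⟨s, hs1, hs2⟩ := (hj.1.and (Ioo_mem_nhdsLT ht0t)).exists
    have hst : c t = c s := by
      refine h.eq_of_forall_not_isIntTime hc (S := Set.Icc t s) Set.ordConnected_Icc
        (fun x hx => ⟨ht.1.trans_le hx.1, (hx.2.trans_lt hs2.2).trans ht0.2⟩) (fun x hx => ?_)
        ⟨le_rfl, hs2.1.le⟩ ⟨hs2.1.le, le_rfl⟩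
      have hbx : x * q < (b : ℝ) + 1 := (lt_div_iff₀ hq').1 (hx.2.trans_lt hs2.2)
      refine ⟨not_isIntTime_of_mem (m := a) (by nlinarith [hx.1]) ?_,
        not_isIntTime_of_mem (m := b) (by nlinarith [hx.1]) hbx⟩
      have : x * p * q < ((a : ℝ) + 1) * q := by nlinarith
      exact lt_of_mul_lt_mul_right this hq'.le
    rw [hs1, hck] at hst
    exact hi (hst ▸ hk)
  -- With neither entry below nor exit above, the segment would be flatter than the diagonal: `bp <
  -- aq` and `(a + 1)q < (b + 1)p` give `q < p`. In the rows `b = 0` and `b + 1 = q` an end point of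
  -- the segment replaces the missing inequality.
  by_cases h1 : b = 0 <;> by_cases h2 : b + 1 = q
  · omega
  · have := mt (And.intro (lt_of_le_of_ne (by omega) h2)) no_exit
    rw [not_le, h1] at this
    nlinarith
  · have := mt (And.intro (show 1 ≤ b by omega)) no_entry
    rw [not_le] at this
    nlinarith
  · have h3 := mt (And.intro (show 1 ≤ b by omega)) no_entry
    have h4 := mt (And.intro (lt_of_le_of_ne (by omega) h2)) no_exit
    rw [not_le] at h3 h4
    nlinarith

/-- The effect of a multiple of a double horizontal Dehn twist. -/
theorem twist (h : T.IsCoding p q c) (hr : T.right * T.right = 1) (hp : p ≠ 0) (e : ℤ)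
    (hpq : p + 2 * e * q ≠ 0) :
    T.IsCoding (p + 2 * e * q) q
      (fun s => (T.right ^ (⌊s * ((p + 2 * e * q : ℤ) : ℝ)⌋ - ⌊s * (p : ℝ)⌋)) (c s)) := by
  have hint : ∀ {t}, IsIntTime q t → (IsIntTime (p + 2 * e * q) t ↔ IsIntTime p t) := by
    rintro t ⟨m, hm⟩
    constructor
    · rintro ⟨k, hk⟩
      exact ⟨k - 2 * e * m, by push_cast at hk ⊢; linear_combination hk - 2 * e * hm⟩
    · rintro ⟨k, hk⟩
      exact ⟨k + 2 * e * m, by push_cast at hk ⊢; linear_combination hk + 2 * e * hm⟩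
  have hinv : T.right⁻¹ = T.right := inv_eq_of_mul_eq_one_left hr
  have hodd : ∀ d ε : ℤ, (ε = 1 ∨ ε = -1) → T.right ^ (d + ε) = T.right * T.right ^ d := by
    rintro d ε (rfl | rfl)
    · rw [add_comm, zpow_one_add]
    · rw [add_comm, zpow_add, zpow_neg_one, hinv]
  have hodd' : ∀ d ε : ℤ, (ε = 1 ∨ ε = -1) → T.right ^ (d - ε) = T.right * T.right ^ d := by
    intro d ε hε
    exact hodd d (-ε) (by omega)
  have hcancel : ∀ i, T.right (T.right i) = i := fun i => by
    rw [← Equiv.Perm.mul_apply, hr, Equiv.Perm.one_apply]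
  have hcomm : ∀ (d : ℤ) i, (T.right ^ d) (T.right i) = T.right ((T.right ^ d) i) := fun d i => by
    rw [← Equiv.Perm.mul_apply, ← Equiv.Perm.mul_apply, (Commute.refl T.right).zpow_left d |>.eq]
  have hfloor : ∀ {p : ℤ} {t : ℝ}, ¬IsIntTime p t →
      JumpsAt (fun s : ℝ => ⌊s * (p : ℝ)⌋) t ⌊t * (p : ℝ)⌋ ⌊t * (p : ℝ)⌋ := fun h =>
    jumpsAt_of_eventually_eq (eventually_floor_eq h)
  -- The exponent counts the squares by which the shear displaces the point. A vertical crossing of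
  -- the old segment changes both `c` and the parity of the exponent, and these effects cancel; one
  -- of the new segment changes the parity alone and produces the required jump.
  refine ⟨fun t ht h1 h2 => h.avoids t ht ((hint h2).1 h1) h2, ?_, ?_, ?_⟩
  · intro t ht hp1 hq1
    have hd' := hfloor hp1
    by_cases hp2 : IsIntTime p t
    · obtain ⟨i, hi⟩ := h.right t ht hp2
      obtain ⟨a, ε, hε, hd⟩ := exists_jumpsAt_floor hp hp2
      have := (hd'.map₂ hd fun x y => x - y).map₂ hi fun d i => (T.right ^ d) i
      rw [← sub_sub, hodd' _ _ hε, Equiv.Perm.mul_apply, hcomm, hcancel] at this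
      exact ⟨_, this⟩
    · obtain ⟨i, hi⟩ := h.const t ht hp2 hq1
      exact ⟨_, (hd'.map₂ (hfloor hp2) fun x y => x - y).map₂ hi fun d i => (T.right ^ d) i⟩
  · intro t ht hp1
    have hq1 : ¬IsIntTime q t := fun hq1 => h.avoids t ht ((hint hq1).1 hp1) hq1
    obtain ⟨a', ε', hε', hd'⟩ := exists_jumpsAt_floor hpq hp1
    by_cases hp2 : IsIntTime p t
    · obtain ⟨i, hi⟩ := h.right t ht hp2
      obtain ⟨a, ε, hε, hd⟩ := exists_jumpsAt_floor hp hp2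
      have := (hd'.map₂ hd fun x y => x - y).map₂ hi fun d i => (T.right ^ d) i
      rw [← sub_sub, hodd' _ _ hε, add_sub_right_comm, hodd _ _ hε', Equiv.Perm.mul_apply,
        Equiv.Perm.mul_apply, hcancel, hcomm] at this
      exact ⟨_, this⟩
    · obtain ⟨i, hi⟩ := h.const t ht hp2 hq1
      have := (hd'.map₂ (hfloor hp2) fun x y => x - y).map₂ hi fun d i => (T.right ^ d) i
      rw [add_sub_right_comm, hodd _ _ hε', Equiv.Perm.mul_apply] at this
      exact ⟨_, this⟩
  · intro t ht hq1
    have hp2 : ¬IsIntTime p t := fun hp2 => h.avoids t ht hp2 hq1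
    have hp1 : ¬IsIntTime (p + 2 * e * q) t := fun hp1 => hp2 ((hint hq1).1 hp1)
    obtain ⟨i, hi', hi⟩ := h.up t ht hq1
    have := ((hfloor hp1).map₂ (hfloor hp2) fun x y => x - y).map₂ hi fun d i => (T.right ^ d) i
    refine ⟨i, hi', ?_⟩
    obtain ⟨m, hm⟩ := hq1
    -- At an integral height the shear is a translation by an even integer, so the power of
    -- `T.right` is trivial and the horizontal edge crossed is unchanged.
    have heq : ⌊t * ((p + 2 * e * q : ℤ) : ℝ)⌋ - ⌊t * (p : ℝ)⌋ = 2 * (e * m) := by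
      have : t * ((p + 2 * e * q : ℤ) : ℝ) = t * p + ((2 * (e * m) : ℤ) : ℝ) := by
        push_cast
        linear_combination 2 * e * hm
      rw [this, Int.floor_add_intCast]
      ring
    rwa [heq, zpow_mul, zpow_two, hr, one_zpow, Equiv.Perm.one_apply, Equiv.Perm.one_apply] at this

end IsCoding

/-- Every segment of height one has a coding. -/
theorem exists_isCoding_one (T : SlitSquareTiling ι) (hr : T.right * T.right = 1) (i : ι) {p : ℤ}
    (hp : p ≠ 0) : ∃ c, T.IsCoding p 1 c := by
  refine ⟨fun s => (T.right ^ ⌊s * (p : ℝ)⌋) i, fun t ht _ => not_isIntTime_one ht, ?_, ?_,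
    fun t ht h => (not_isIntTime_one ht h).elim⟩
  · intro t _ h1 _
    exact ⟨_, (jumpsAt_of_eventually_eq (eventually_floor_eq h1)).map fun d => (T.right ^ d) i⟩
  · intro t _ h1
    obtain ⟨a, ε, hε, hd⟩ := exists_jumpsAt_floor hp h1
    have := hd.map fun d => (T.right ^ d) i
    have hodd : T.right ^ (a + ε) = T.right * T.right ^ a := by
      rcases hε with rfl | rfl
      · rw [add_comm, zpow_one_add]
      · rw [add_comm, zpow_add, zpow_neg_one, inv_eq_of_mul_eq_one_left hr]
    rw [hodd, Equiv.Perm.mul_apply] at this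
    exact ⟨_, this⟩

end SlitSquareTiling

/-! ### Codings on staircases -/

theorem staircaseRight_mul_self (n : ℕ) : staircaseRight n * staircaseRight n = 1 :=
  Equiv.ext fun j => (Function.Involutive.toPerm_involutive _) j

theorem staircaseUp_apply_apply (n : ℕ) (j : Fin (n + 1)) : staircaseUp n (staircaseUp n j) = j :=
  (Function.Involutive.toPerm_involutive _) j

theorem staircaseUp_zero (n : ℕ) : staircaseUp n 0 = 0 := by
  ext
  simp [staircaseUp]

theorem staircaseRight_succ_zero (n : ℕ) : staircaseRight (n + 1) (Fin.succ 0) = 0 := by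
  ext
  simp [staircaseRight]

theorem val_staircaseRight {n : ℕ} (j : Fin (n + 1)) : (staircaseRight n j).val =
    if j.val % 2 = 0 then (if j.val + 1 ≤ n then j.val + 1 else j.val) else j.val - 1 := by
  change Fin.val (if j.val % 2 = 0 then
    (if h : j.val + 1 ≤ n then ⟨j.val + 1, by omega⟩ else j) else ⟨j.val - 1, by omega⟩) = _
  split_ifs <;> rfl

theorem val_staircaseUp {n : ℕ} (j : Fin (n + 1)) : (staircaseUp n j).val =
    if j.val % 2 = 1 then (if j.val + 1 ≤ n then j.val + 1 else j.val) else j.val - 1 := by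
  change Fin.val (if j.val % 2 = 1 then
    (if h : j.val + 1 ≤ n then ⟨j.val + 1, by omega⟩ else j)
      else if j.val = 0 then j else ⟨j.val - 1, by omega⟩) = _
  split_ifs <;> simp_all

/-- Square 0 is excluded because its top edge, the slit, is where the reflected staircase is opened
to attach the new square. -/
theorem staircaseRight_succ {n : ℕ} {j : Fin (n + 1)} (hj : j ≠ 0) :
    staircaseRight (n + 1) j.succ = (staircaseUp n j).succ := by
  have hj' : j.val ≠ 0 := fun h => hj (Fin.ext h)
  ext
  simp only [val_staircaseRight, val_staircaseUp, Fin.val_succ]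
  split_ifs <;> omega

theorem staircaseUp_succ {n : ℕ} (j : Fin (n + 1)) :
    staircaseUp (n + 1) j.succ = (staircaseRight n j).succ := by
  ext
  simp only [val_staircaseRight, val_staircaseUp, Fin.val_succ]
  split_ifs <;> omega

open SlitSquareTiling

/-- Reflection in the diagonal. A segment avoiding the old slit never uses the only gluing that
changes, and it stays away from square 0, which carries the new slit. -/
theorem SlitSquareTiling.IsCoding.staircase_succ {n : ℕ} {p q : ℤ} {c : ℝ → Fin (n + 1)}
    (h : (staircaseSurface n).IsCoding p q c) :
    (staircaseSurface (n + 1)).IsCoding q p fun s => (c s).succ where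
  avoids t ht hq hp := h.avoids t ht hp hq
  const t ht hq hp := by
    obtain ⟨i, hi⟩ := h.const t ht hp hq
    exact ⟨_, hi.map Fin.succ⟩
  right t ht hq := by
    obtain ⟨i, hi0, hi⟩ := h.up t ht hq
    refine ⟨i.succ, ?_⟩
    have := hi.map Fin.succ
    rwa [show (staircaseSurface (n + 1)).right i.succ = ((staircaseSurface n).up i).succ from
      staircaseRight_succ hi0]
  up t ht hp := by
    obtain ⟨i, hi⟩ := h.right t ht hp
    refine ⟨i.succ, Fin.succ_ne_zero i, ?_⟩
    have := hi.map Fin.succ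
    rwa [show (staircaseSurface (n + 1)).up i.succ = ((staircaseSurface n).right i).succ from
      staircaseUp_succ i]

/-- Converse reflection: a steep segment misses square 0, so it lives on the reflected smaller
staircase. -/
theorem SlitSquareTiling.IsCoding.exists_staircase_pred {n : ℕ} {p q : ℤ} {c : ℝ → Fin (n + 2)}
    (h : (staircaseSurface (n + 1)).IsCoding p q c) (hp : p ≠ 0) (hpq : |p| < |q|) :
    ∃ c', (staircaseSurface n).IsCoding q p c' := by
  have hq : q ≠ 0 := by
    rintro rfl
    exact absurd hpq (by simp)
  obtain ⟨d, hd, hdc⟩ := h.exists_rightContinuous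
  have hne : ∀ t ∈ Set.Ioo (0 : ℝ) 1, ¬IsIntTime p t → ¬IsIntTime q t → d t ≠ 0 := by
    intro t ht htp htq
    exact hd.abs.ne_of_lt hdc (abs_pos.2 hp) hpq (k := 0) rfl (staircaseUp_zero _) ht
      (by rwa [isIntTime_abs]) (by rwa [isIntTime_abs])
  have hne' : ∀ t ∈ Set.Ioo (0 : ℝ) 1, ∀ {i j}, JumpsAt d t i j → i ≠ 0 ∧ j ≠ 0 := by
    intro t ht i j hj
    refine hj.forall_of_eventually (P := fun i => i ≠ 0) ?_
    filter_upwards [eventually_not_isIntTime hp t, eventually_not_isIntTime hq t,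
      eventually_nhdsWithin_of_eventually_nhds (Ioo_mem_nhds ht.1 ht.2)] with s h1 h2 h3
    exact hne s h3 h1 h2
  -- The value at 0 is a dummy: no one-sided limit of `d` is 0.
  let f : Fin (n + 2) → Fin (n + 1) := Fin.cases 0 id
  have hf : ∀ i : Fin (n + 1), f i.succ = i := fun i => rfl
  refine ⟨fun s => f (d s), fun t ht hq hp => hd.avoids t ht hp hq, ?_, ?_, ?_⟩
  · intro t ht htq htp
    obtain ⟨i, hi⟩ := hd.const t ht htp htq
    exact ⟨_, hi.map f⟩
  · intro t ht htq
    obtain ⟨i, -, hi⟩ := hd.up t ht htq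
    obtain ⟨i, rfl⟩ := Fin.exists_succ_eq.2 (hne' t ht hi).1
    have := hi.map f
    rw [show (staircaseSurface (n + 1)).up i.succ = ((staircaseSurface n).right i).succ from
      staircaseUp_succ i] at this
    exact ⟨i, this⟩
  · intro t ht htp
    obtain ⟨i, hi⟩ := hd.right t ht htp
    obtain ⟨h1, h2⟩ := hne' t ht hi
    obtain ⟨i, rfl⟩ := Fin.exists_succ_eq.2 h1
    -- Crossing the old slit would mean passing from square 1 into square 0.
    have hi0 : i ≠ 0 := by
      rintro rfl
      exact h2 (staircaseRight_succ_zero n)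
    have := hi.map f
    rw [show (staircaseSurface (n + 1)).right i.succ = ((staircaseSurface n).up i).succ from
      staircaseRight_succ hi0] at this
    exact ⟨i, hi0, this⟩

/-! ### Renormalization of the slope sets -/

/-- The slopes `Re v / Im v` of the holonomy vectors `v` of the non-horizontal saddle connections
of the staircase surface which avoid the slit. -/
def staircaseSlopes (n : ℕ) : Set ℝ :=
  {x | x = 0 ∨ ∃ p q : ℤ, p ≠ 0 ∧ q ≠ 0 ∧ x = p / q ∧ ∃ c, (staircaseSurface n).IsCoding p q c}

theorem isStaircaseSlopes : IsStaircaseSlopes staircaseSlopes := by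
  have hint : ∀ (n : ℕ) (m : ℤ), (m : ℝ) ∈ staircaseSlopes n := by
    intro n m
    by_cases hm : m = 0
    · exact Or.inl (by rw [hm, Int.cast_zero])
    · exact Or.inr ⟨m, 1, hm, one_ne_zero, by simp,
        exists_isCoding_one _ (staircaseRight_mul_self n) 0 hm⟩
  refine ⟨hint, ?_, ?_, ?_, ?_⟩
  · rintro x (rfl | ⟨p, q, hp, hq, rfl, c, hc⟩)
    · exact ⟨0, by simp⟩
    -- Otherwise the segment crosses a horizontal edge at time `1 / |q|`, and on one square every
    -- such edge is the slit.
    have hq1 : |q| = 1 := by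
      by_contra hne
      have h1 : 1 < |q| := lt_of_le_of_ne (Int.one_le_abs hq) (Ne.symm hne)
      have h2 : (1 : ℝ) < ((|q| : ℤ) : ℝ) := by exact_mod_cast h1
      obtain ⟨i, hi, -⟩ := hc.abs.up (((|q| : ℤ) : ℝ)⁻¹)
        ⟨by positivity, inv_lt_one_of_one_lt₀ h2⟩ ⟨1, by
          rw [inv_mul_cancel₀ (by positivity)]; simp⟩
      exact hi (Subsingleton.elim (α := Fin 1) _ _)
    rcases (abs_eq zero_le_one).1 hq1 with rfl | rfl
    · exact ⟨p, by simp⟩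
    · exact ⟨-p, by simp [div_neg]⟩
  · rintro n e x (rfl | ⟨p, q, hp, hq, rfl, c, hc⟩)
    · have := hint n (2 * e)
      rw [zero_add]
      exact_mod_cast this
    have hq' : (q : ℝ) ≠ 0 := Int.cast_ne_zero.2 hq
    have hx : (p : ℝ) / q + 2 * e = ((p + 2 * e * q : ℤ) : ℝ) / q := by
      push_cast
      field_simp
    rw [hx]
    by_cases h0 : p + 2 * e * q = 0
    · exact Or.inl (by rw [h0]; simp)
    · exact Or.inr ⟨_, q, h0, hq, rfl, _, hc.twist (staircaseRight_mul_self n) hp e h0⟩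
  · rintro n x (rfl | ⟨p, q, hp, hq, rfl, c, hc⟩) hx
    · exact (hx rfl).elim
    · exact Or.inr ⟨q, p, hq, hp, inv_div _ _, _, hc.staircase_succ⟩
  · rintro n x (rfl | ⟨p, q, hp, hq, rfl, c, hc⟩) hx hlt
    · exact (hx rfl).elim
    · refine Or.inr ⟨q, p, hq, hp, inv_div _ _, hc.exists_staircase_pred hp ?_⟩
      rw [abs_div, div_lt_one (abs_pos.2 (Int.cast_ne_zero.2 hq))] at hlt
      exact_mod_cast hlt

namespace SlitSquareTiling

variable {ι : Type} (T : SlitSquareTiling ι)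

/-! ### Points of the surface -/

theorem point_eq_of_mem (i : ι) {z : ℂ} (hx : z.re ∈ Set.Icc (0 : ℝ) 1)
    (hy : z.im ∈ Set.Icc (0 : ℝ) 1) : T.point i z = Quot.mk _ ⟨i, ⟨z.re, hx⟩, ⟨z.im, hy⟩⟩ := by
  rw [point, Set.projIcc_of_mem _ hx, Set.projIcc_of_mem _ hy]

theorem continuous_point (i : ι) : Continuous (T.point i) :=
  continuous_quot_mk.comp (continuous_sigmaMk.comp
    ((continuous_projIcc.comp Complex.continuous_re).prodMk
      (continuous_projIcc.comp Complex.continuous_im)))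

theorem point_eq_point_right (i : ι) {z : ℂ} (hz : z.re = 1) :
    T.point i z = T.point (T.right i) (z - 1) := by
  have h1 : Set.projIcc (0 : ℝ) 1 zero_le_one 1 = 1 := Set.projIcc_right _
  have h0 : Set.projIcc (0 : ℝ) 1 zero_le_one 0 = 0 := Set.projIcc_left _
  simp only [point, Complex.sub_re, Complex.sub_im, Complex.one_re, Complex.one_im, hz, sub_self,
    sub_zero, h0, h1]
  exact Quot.sound (Glue.right i _)

theorem point_eq_point_up (i : ι) {z : ℂ} (hz : z.im = 1) :
    T.point i z = T.point (T.up i) (z - Complex.I) := by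
  have h1 : Set.projIcc (0 : ℝ) 1 zero_le_one 1 = 1 := Set.projIcc_right _
  have h0 : Set.projIcc (0 : ℝ) 1 zero_le_one 0 = 0 := Set.projIcc_left _
  simp only [point, Complex.sub_re, Complex.sub_im, Complex.I_re, Complex.I_im, hz, sub_self,
    sub_zero, h0, h1]
  exact Quot.sound (Glue.up i _)

theorem continuous_unfoldRight (i : ι) : Continuous (T.unfoldRight i) :=
  Continuous.if_le (T.continuous_point i) ((T.continuous_point _).comp (by fun_prop))
    Complex.continuous_re continuous_const fun _ hz => T.point_eq_point_right i hz

theorem continuous_unfoldUp (i : ι) : Continuous (T.unfoldUp i) :=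
  Continuous.if_le (T.continuous_point i) ((T.continuous_point _).comp (by fun_prop))
    Complex.continuous_im continuous_const fun _ hz => T.point_eq_point_up i hz

variable {T}

theorem IsStraightAt.continuousAt {γ : ℝ → T.Surface} {v : ℂ} {t : ℝ}
    (h : T.IsStraightAt γ v t) : ContinuousAt γ t := by
  obtain ⟨i, w, ⟨-, h⟩ | ⟨-, h⟩⟩ := h
  · exact (((T.continuous_unfoldRight i).comp (by fun_prop :
      Continuous fun s : ℝ => w + ((s - t : ℝ) : ℂ) * v)).continuousAt).congr (Filter.EventuallyEq.symm h)
  · exact (((T.continuous_unfoldUp i).comp (by fun_prop :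
      Continuous fun s : ℝ => w + ((s - t : ℝ) : ℂ) * v)).continuousAt).congr (Filter.EventuallyEq.symm h)

variable (T)

/-- The covering of the square torus, branched over one point. -/
def toTorus : T.Surface → UnitAddCircle × UnitAddCircle :=
  Quot.lift (fun s => (((s.2.1 : ℝ) : UnitAddCircle), ((s.2.2 : ℝ) : UnitAddCircle))) (by
    rintro _ _ (⟨i, y⟩ | ⟨i, x⟩)
    · simp [AddCircle.coe_period]
    · simp [AddCircle.coe_period])

theorem continuous_toTorus : Continuous T.toTorus := by
  refine continuous_quot_lift _ (continuous_sigma fun i => ?_)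
  exact ((AddCircle.continuous_mk' _).comp (continuous_subtype_val.comp continuous_fst)).prodMk
    ((AddCircle.continuous_mk' _).comp (continuous_subtype_val.comp continuous_snd))

theorem toTorus_point (i : ι) {z : ℂ} (hx : z.re ∈ Set.Icc (0 : ℝ) 1)
    (hy : z.im ∈ Set.Icc (0 : ℝ) 1) : T.toTorus (T.point i z) = (↑z.re, ↑z.im) := by
  rw [point_eq_of_mem T i hx hy]
  rfl

theorem toTorus_unfoldRight (i : ι) {z : ℂ} (hx : z.re ∈ Set.Ioo (0 : ℝ) 2)
    (hy : z.im ∈ Set.Ioo (0 : ℝ) 1) : T.toTorus (T.unfoldRight i z) = (↑z.re, ↑z.im) := by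
  have hy' := Set.Ioo_subset_Icc_self hy
  unfold unfoldRight
  split_ifs with h
  · exact T.toTorus_point i ⟨hx.1.le, h⟩ hy'
  · rw [T.toTorus_point _ (by simp; constructor <;> linarith [hx.2]) (by simpa using hy')]
    simp [AddCircle.coe_period]

theorem toTorus_unfoldUp (i : ι) {z : ℂ} (hx : z.re ∈ Set.Ioo (0 : ℝ) 1)
    (hy : z.im ∈ Set.Ioo (0 : ℝ) 2) : T.toTorus (T.unfoldUp i z) = (↑z.re, ↑z.im) := by
  have hx' := Set.Ioo_subset_Icc_self hx
  unfold unfoldUp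
  split_ifs with h
  · exact T.toTorus_point i hx' ⟨hy.1.le, h⟩
  · rw [T.toTorus_point _ (by simpa using hx') (by simp; constructor <;> linarith [hy.2])]
    simp [AddCircle.coe_period]

theorem toTorus_of_mem_distinguished {x : T.Surface} (hx : x ∈ T.distinguished) :
    T.toTorus x = 0 := by
  obtain ⟨i, z, h1, h2, rfl⟩ := hx
  have hz : ∀ {a : ℝ}, a = 0 ∨ a = 1 → (a : UnitAddCircle) = 0 := by
    rintro a (rfl | rfl)
    · simp
    · exact AddCircle.coe_period 1
  have hI : ∀ {a : ℝ}, a = 0 ∨ a = 1 → a ∈ Set.Icc (0 : ℝ) 1 := by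
    rintro a (rfl | rfl) <;> simp
  rw [T.toTorus_point i (hI h1) (hI h2), hz h1, hz h2]
  rfl

open Classical in
/-- The square whose interior contains a given point. -/
noncomputable def square? : T.Surface → Option ι :=
  Quot.lift (fun s => if s.2.1 ∈ Set.Ioo 0 1 ∧ s.2.2 ∈ Set.Ioo 0 1 then some s.1 else none) (by
    rintro _ _ (⟨i, y⟩ | ⟨i, x⟩) <;> simp)

theorem square?_point (i : ι) {z : ℂ} (hx : z.re ∈ Set.Ioo (0 : ℝ) 1)
    (hy : z.im ∈ Set.Ioo (0 : ℝ) 1) : T.square? (T.point i z) = some i := by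
  rw [T.point_eq_of_mem i (Set.Ioo_subset_Icc_self hx) (Set.Ioo_subset_Icc_self hy)]
  exact if_pos ⟨hx, hy⟩

/-- The points in the interiors of the slits, described in a way that is compatible with the
gluings. -/
def onSlit : T.Surface → Prop :=
  Quot.lift (fun s => s.2.1 ∈ Set.Ioo 0 1 ∧
    ((s.2.2 = 1 ∧ s.1 ∈ T.slits) ∨ (s.2.2 = 0 ∧ T.up.symm s.1 ∈ T.slits))) (by
    rintro _ _ (⟨i, y⟩ | ⟨i, x⟩) <;> simp)

theorem onSlit_of_mem_slitInterior {x : T.Surface} (hx : x ∈ T.slitInterior) : T.onSlit x := by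
  obtain ⟨i, hi, x, hx, rfl⟩ := hx
  have hre : ((x : ℂ) + Complex.I).re = x := by simp
  have him : ((x : ℂ) + Complex.I).im = 1 := by simp
  rw [T.point_eq_of_mem i (by rw [hre]; exact Set.Ioo_subset_Icc_self hx) (by rw [him]; simp)]
  exact ⟨by rw [← hre] at hx; exact hx, Or.inl ⟨Subtype.ext him, hi⟩⟩

variable {T}

/-! ### From saddle connections to codings -/

theorem IsStraightAt.eventually_toTorus {γ : ℝ → T.Surface} {v : ℂ} {t : ℝ}
    (h : T.IsStraightAt γ v t) : ∀ᶠ s in 𝓝 t, T.toTorus (γ s) =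
      T.toTorus (γ t) + ((((s - t) * v.re : ℝ) : UnitAddCircle), (((s - t) * v.im : ℝ) :
        UnitAddCircle)) := by
  obtain ⟨i, w, ⟨hw, h⟩ | ⟨hw, h⟩⟩ := h <;> rw [Complex.mem_reProdIm] at hw
  all_goals
    have hre : ∀ᶠ s : ℝ in 𝓝 t, (w + ((s - t : ℝ) : ℂ) * v).re ∈ Set.Ioo _ _ :=
      (by fun_prop : Continuous fun s : ℝ => (w + ((s - t : ℝ) : ℂ) * v).re).continuousAt.eventually
        (Ioo_mem_nhds (by simpa using hw.1.1) (by simpa using hw.1.2))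
    have him : ∀ᶠ s : ℝ in 𝓝 t, (w + ((s - t : ℝ) : ℂ) * v).im ∈ Set.Ioo _ _ :=
      (by fun_prop : Continuous fun s : ℝ => (w + ((s - t : ℝ) : ℂ) * v).im).continuousAt.eventually
        (Ioo_mem_nhds (by simpa using hw.2.1) (by simpa using hw.2.2))
    filter_upwards [h, hre, him] with s hs h1 h2
    rw [hs, h.self_of_nhds]
  · rw [T.toTorus_unfoldRight i h1 h2, T.toTorus_unfoldRight i (by simpa using hw.1)
      (by simpa using hw.2)]
    simp
  · rw [T.toTorus_unfoldUp i h1 h2, T.toTorus_unfoldUp i (by simpa using hw.1)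
      (by simpa using hw.2)]
    simp

/-- The projection of `γ` and the line `t ↦ t v` differ by a locally constant element of the torus,
which continuity at the initial corner forces to be 0. -/
theorem IsSaddleConnection.toTorus_eq {γ : ℝ → T.Surface} {v : ℂ}
    (h : T.IsSaddleConnection γ v) : ∀ t ∈ Set.Icc (0 : ℝ) 1,
      T.toTorus (γ t) = (((t * v.re : ℝ) : UnitAddCircle), ((t * v.im : ℝ) : UnitAddCircle)) := by
  let L : ℝ → UnitAddCircle × UnitAddCircle := fun t => (((t * v.re : ℝ)), ((t * v.im : ℝ)))
  have hL : Continuous L :=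
    ((AddCircle.continuous_mk' _).comp (by fun_prop)).prodMk
      ((AddCircle.continuous_mk' _).comp (by fun_prop))
  have hdiff : ∀ s t, ((((s - t) * v.re : ℝ) : UnitAddCircle), (((s - t) * v.im : ℝ) :
      UnitAddCircle)) = L s - L t := by
    intro s t
    simp [L, sub_mul]
  have hconst : ∀ s ∈ Set.Ioo (0 : ℝ) 1, ∀ t ∈ Set.Ioo (0 : ℝ) 1,
      T.toTorus (γ s) - L s = T.toTorus (γ t) - L t := by
    intro s hs t ht
    refine eq_of_forall_eventually_eq (f := fun s => T.toTorus (γ s) - L s) Set.ordConnected_Ioo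
      (fun x hx => ?_) hs ht
    filter_upwards [(h.straight x hx).eventually_toTorus] with y hy
    rw [hy, hdiff]
    abel
  have hhalf : (1 / 2 : ℝ) ∈ Set.Ioo (0 : ℝ) 1 := by norm_num
  set C := T.toTorus (γ (1 / 2)) - L (1 / 2)
  have heq : Set.EqOn (fun t => T.toTorus (γ t)) (fun t => C + L t) (Set.Icc 0 1) := by
    refine Set.EqOn.of_subset_closure (s := Set.Ioo 0 1) ?_
      (T.continuous_toTorus.comp_continuousOn h.continuousOn) (by fun_prop)
      Set.Ioo_subset_Icc_self (by rw [closure_Ioo zero_ne_one])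
    intro t ht
    exact sub_eq_iff_eq_add.1 (hconst t ht _ hhalf)
  have hC : C = 0 := by
    have := heq (Set.left_mem_Icc.2 zero_le_one)
    simp only [T.toTorus_of_mem_distinguished h.source_mem] at this
    have hL0 : L 0 = 0 := by simp [L]
    rw [hL0, add_zero] at this
    exact this.symm
  intro t ht
  have := heq ht
  simp only [hC, zero_add] at this
  exact this

theorem exists_int_of_coe_eq_coe {x y : ℝ} (h : (x : UnitAddCircle) = y) : ∃ n : ℤ, x = y + n := by
  rw [← sub_eq_zero, ← AddCircle.coe_sub, AddCircle.coe_eq_zero_iff] at h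
  obtain ⟨n, hn⟩ := h
  exact ⟨n, by simp at hn; linarith⟩

/-- The behaviour of a path of cells which runs through two adjacent unit intervals. -/
theorem jumpsAt_of_chart {α : Type*} {c : ℝ → α} {x v t : ℝ} {i j : α} (hx : x ∈ Set.Ioo (0 : ℝ) 2)
    (hv : v ≠ 0) (hi : ∀ᶠ s in 𝓝 t, x + (s - t) * v ∈ Set.Ioo (0 : ℝ) 1 → c s = i)
    (hj : ∀ᶠ s in 𝓝 t, x + (s - t) * v ∈ Set.Ioo (1 : ℝ) 2 → c s = j) :
    (x ≠ 1 → ∃ k, JumpsAt c t k k) ∧ (x = 1 → JumpsAt c t i j ∨ JumpsAt c t j i) := by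
  have hmem : ∀ {a b : ℝ}, x ∈ Set.Ioo a b → ∀ᶠ s in 𝓝 t, x + (s - t) * v ∈ Set.Ioo a b := by
    intro a b hab
    exact (by fun_prop : Continuous fun s : ℝ => x + (s - t) * v).continuousAt.eventually
      (Ioo_mem_nhds (by simpa using hab.1) (by simpa using hab.2))
  constructor
  · intro hne
    rcases lt_or_gt_of_ne hne with hlt | hgt
    · refine ⟨i, jumpsAt_of_eventually_eq ?_⟩
      filter_upwards [hi, hmem ⟨hx.1, hlt⟩] with s h1 h2 using h1 h2
    · refine ⟨j, jumpsAt_of_eventually_eq ?_⟩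
      filter_upwards [hj, hmem ⟨hgt, hx.2⟩] with s h1 h2 using h1 h2
  · rintro rfl
    have hm := hmem hx
    rcases lt_or_gt_of_ne hv with hneg | hpos
    · right
      constructor
      · filter_upwards [eventually_nhdsWithin_of_eventually_nhds hj,
          eventually_nhdsWithin_of_eventually_nhds hm, self_mem_nhdsWithin]
          with s h1 h2 (hst : s < t)
        exact h1 ⟨by nlinarith, h2.2⟩
      · filter_upwards [eventually_nhdsWithin_of_eventually_nhds hi,
          eventually_nhdsWithin_of_eventually_nhds hm, self_mem_nhdsWithin]
          with s h1 h2 (hst : t < s)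
        exact h1 ⟨h2.1, by nlinarith⟩
    · left
      constructor
      · filter_upwards [eventually_nhdsWithin_of_eventually_nhds hi,
          eventually_nhdsWithin_of_eventually_nhds hm, self_mem_nhdsWithin]
          with s h1 h2 (hst : s < t)
        exact h1 ⟨h2.1, by nlinarith⟩
      · filter_upwards [eventually_nhdsWithin_of_eventually_nhds hj,
          eventually_nhdsWithin_of_eventually_nhds hm, self_mem_nhdsWithin]
          with s h1 h2 (hst : t < s)
        exact h1 ⟨by nlinarith, h2.2⟩

theorem isIntTime_iff_eq_one {p n : ℤ} {t x : ℝ} (hx : x ∈ Set.Ioo (0 : ℝ) 2) (h : x = t * p + n) :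
    IsIntTime p t ↔ x = 1 := by
  constructor
  · rintro ⟨m, hm⟩
    rw [hm] at h
    rw [h] at hx ⊢
    have h1 : 0 < m + n := by exact_mod_cast hx.1
    have h2 : m + n < 2 := by exact_mod_cast hx.2
    exact_mod_cast (by omega : m + n = 1)
  · rintro rfl
    exact ⟨1 - n, by push_cast; linarith⟩

theorem not_isIntTime_of_eq {p n : ℤ} {t x : ℝ} (hx : x ∈ Set.Ioo (0 : ℝ) 1) (h : x = t * p + n) :
    ¬IsIntTime p t :=
  not_isIntTime_of_mem (m := -n) (by push_cast; linarith [hx.1]) (by push_cast; linarith [hx.2])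

/-- Both end points lie over 0 in the torus, so the holonomy is integral. An edge is crossed exactly
when the flat chart at that time is centred on the edge common to its two squares. -/
theorem IsSaddleConnection.exists_isCoding [Nonempty ι] (hr : ∀ i, T.right (T.right i) = i)
    (hu : ∀ i, T.up (T.up i) = i) (hus : ∀ i, T.up i ∈ T.slits → i ∈ T.slits) {γ : ℝ → T.Surface} {v : ℂ} (h : T.IsSaddleConnection γ v)
    (hslit : ∀ t ∈ Set.Ioo (0 : ℝ) 1, γ t ∉ T.slitInterior) (hre : v.re ≠ 0) (him : v.im ≠ 0) :
    ∃ p q : ℤ, v.re = p ∧ v.im = q ∧ ∃ c, T.IsCoding p q c := by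
  have htorus := h.toTorus_eq
  have hend := htorus 1 (Set.right_mem_Icc.2 zero_le_one)
  rw [T.toTorus_of_mem_distinguished h.target_mem, one_mul, one_mul, Prod.ext_iff] at hend
  obtain ⟨p, hp⟩ := exists_int_of_coe_eq_coe (y := 0) (by simpa using hend.1.symm)
  obtain ⟨q, hq⟩ := exists_int_of_coe_eq_coe (y := 0) (by simpa using hend.2.symm)
  rw [zero_add] at hp hq
  refine ⟨p, q, hp, hq, fun s => (T.square? (γ s)).getD (Classical.arbitrary ι), ?_⟩
  set c : ℝ → ι := fun s => (T.square? (γ s)).getD (Classical.arbitrary ι) with hc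
  have hcs : ∀ {s i z}, γ s = T.point i z → z.re ∈ Set.Ioo (0 : ℝ) 1 → z.im ∈ Set.Ioo (0 : ℝ) 1 →
      c s = i := by
    intro s i z hs h1 h2
    rw [hc]
    beta_reduce
    rw [hs, T.square?_point i h1 h2, Option.getD_some]
  have key : ∀ t ∈ Set.Ioo (0 : ℝ) 1,
      (¬IsIntTime q t ∧ (¬IsIntTime p t → ∃ i, JumpsAt c t i i) ∧
        (IsIntTime p t → ∃ i, JumpsAt c t i (T.right i))) ∨
      (¬IsIntTime p t ∧ (¬IsIntTime q t → ∃ i, JumpsAt c t i i) ∧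
        (IsIntTime q t → ∃ i ∉ T.slits, JumpsAt c t i (T.up i))) := by
    intro t ht
    have hF := htorus t (Set.Ioo_subset_Icc_self ht)
    obtain ⟨i, w, ⟨hw, hγ⟩ | ⟨hw, hγ⟩⟩ := h.straight t ht <;> rw [Complex.mem_reProdIm] at hw
    · left
      rw [hγ.self_of_nhds, T.toTorus_unfoldRight i (by simpa using hw.1) (by simpa using hw.2),
        Prod.ext_iff] at hF
      obtain ⟨n, hn⟩ := exists_int_of_coe_eq_coe hF.1
      obtain ⟨m, hm⟩ := exists_int_of_coe_eq_coe hF.2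
      simp only [sub_self, Complex.ofReal_zero, zero_mul, add_zero] at hn hm
      rw [hp] at hn
      rw [hq] at hm
      have hy : ∀ᶠ s : ℝ in 𝓝 t, (w + ((s - t : ℝ) : ℂ) * v).im ∈ Set.Ioo (0 : ℝ) 1 :=
        (by fun_prop : Continuous fun s : ℝ =>
          (w + ((s - t : ℝ) : ℂ) * v).im).continuousAt.eventually
          (Ioo_mem_nhds (by simpa using hw.2.1) (by simpa using hw.2.2))
      have hchart := jumpsAt_of_chart (c := c) (t := t) (i := i) (j := T.right i) hw.1 hre
        (by
          filter_upwards [hγ, hy] with s hs h1 h2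
          refine hcs (i := i) (z := w + ((s - t : ℝ) : ℂ) * v) ?_ (by simpa using h2) h1
          rw [hs, unfoldRight, if_pos (by simpa using h2.2.le)])
        (by
          filter_upwards [hγ, hy] with s hs h1 h2
          refine hcs (i := T.right i) (z := w + ((s - t : ℝ) : ℂ) * v - 1) ?_
            (by simp; constructor <;> linarith [h2.1, h2.2]) (by simpa using h1)
          rw [hs, unfoldRight, if_neg (by simpa using h2.1)])
      rw [isIntTime_iff_eq_one hw.1 hn]
      refine ⟨not_isIntTime_of_eq hw.2 hm, hchart.1, fun h1 => ?_⟩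
      rcases hchart.2 h1 with hj | hj
      · exact ⟨i, hj⟩
      · exact ⟨T.right i, by rwa [hr]⟩
    · right
      have hγt := hγ.self_of_nhds
      rw [hγt, T.toTorus_unfoldUp i (by simpa using hw.1) (by simpa using hw.2),
        Prod.ext_iff] at hF
      obtain ⟨n, hn⟩ := exists_int_of_coe_eq_coe hF.1
      obtain ⟨m, hm⟩ := exists_int_of_coe_eq_coe hF.2
      simp only [sub_self, Complex.ofReal_zero, zero_mul, add_zero] at hn hm hγt
      rw [hp] at hn
      rw [hq] at hm
      have hx : ∀ᶠ s : ℝ in 𝓝 t, (w + ((s - t : ℝ) : ℂ) * v).re ∈ Set.Ioo (0 : ℝ) 1 :=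
        (by fun_prop : Continuous fun s : ℝ =>
          (w + ((s - t : ℝ) : ℂ) * v).re).continuousAt.eventually
          (Ioo_mem_nhds (by simpa using hw.1.1) (by simpa using hw.1.2))
      have hchart := jumpsAt_of_chart (c := c) (t := t) (i := i) (j := T.up i) hw.2 him
        (by
          filter_upwards [hγ, hx] with s hs h1 h2
          refine hcs (i := i) (z := w + ((s - t : ℝ) : ℂ) * v) ?_ h1 (by simpa using h2)
          rw [hs, unfoldUp, if_pos (by simpa using h2.2.le)])
        (by
          filter_upwards [hγ, hx] with s hs h1 h2
          refine hcs (i := T.up i) (z := w + ((s - t : ℝ) : ℂ) * v - Complex.I) ?_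
            (by simpa using h1) (by simp; constructor <;> linarith [h2.1, h2.2])
          rw [hs, unfoldUp, if_neg (by simpa using h2.1)])
      rw [isIntTime_iff_eq_one hw.2 hm]
      refine ⟨not_isIntTime_of_eq hw.1 hn, hchart.1, fun h1 => ?_⟩
      have hi : i ∉ T.slits := by
        refine fun hi => hslit t ht ⟨i, hi, w.re, hw.1, ?_⟩
        rw [hγt, unfoldUp, if_pos h1.le]
        congr 1
        apply Complex.ext <;> simp [h1]
      rcases hchart.2 h1 with hj | hj
      · exact ⟨i, hi, hj⟩
      -- A downward crossing is read as an upward jump from `T.up i`, since `T.up` is an involution;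
      -- `hus` ensures that this names no slit.
      · exact ⟨T.up i, fun h => hi (hus i h), by rwa [hu]⟩
  refine ⟨fun t ht h1 => ?_, fun t ht h1 h2 => ?_, fun t ht h1 => ?_, fun t ht h1 => ?_⟩ <;>
    rcases key t ht with hk | hk
  · exact hk.1
  · exact absurd h1 hk.1
  · exact hk.2.1 h1
  · exact hk.2.1 h2
  · exact hk.2.2 h1
  · exact absurd h1 hk.1
  · exact absurd h1 hk.1
  · exact hk.2.2 h1

end SlitSquareTiling

namespace SlitSquareTiling

variable {ι : Type} {T : SlitSquareTiling ι}

/-! ### From codings to saddle connections -/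

theorem eventually_fract_eq {p : ℤ} {t : ℝ} (h : ¬IsIntTime p t) :
    ∀ᶠ s in 𝓝 t, Int.fract (s * (p : ℝ)) = Int.fract (t * (p : ℝ)) + (s - t) * p := by
  filter_upwards [eventually_floor_eq h] with s hs
  rw [Int.fract, Int.fract, hs]
  ring

theorem fract_mem_Ioo {p : ℤ} {t : ℝ} (h : ¬IsIntTime p t) :
    Int.fract (t * (p : ℝ)) ∈ Set.Ioo (0 : ℝ) 1 := by
  obtain ⟨h1, -⟩ := not_isIntTime_iff.1 h
  exact ⟨by rw [Int.fract]; linarith, Int.fract_lt_one _⟩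

theorem eventually_fract_lt {p : ℤ} (hp : 0 < p) {t : ℝ} (h : IsIntTime p t) :
    ∀ᶠ s in 𝓝[<] t, Int.fract (s * (p : ℝ)) = 1 + (s - t) * p := by
  obtain ⟨m, hm⟩ := h
  have hp' : (0 : ℝ) < p := by exact_mod_cast hp
  filter_upwards [eventually_nhdsWithin_of_eventually_nhds (eventually_mul_mem_Ioo
    (show (m : ℝ) - 1 < t * p by linarith) (show t * (p : ℝ) < m + 1 by linarith)),
    self_mem_nhdsWithin] with s hs (hst : s < t)
  rw [Int.fract_eq_iff]
  exact ⟨by nlinarith [hs.1], by nlinarith, m - 1, by push_cast; linarith⟩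

theorem eventually_fract_gt {p : ℤ} (hp : 0 < p) {t : ℝ} (h : IsIntTime p t) :
    ∀ᶠ s in 𝓝[>] t, Int.fract (s * (p : ℝ)) = (s - t) * p := by
  obtain ⟨m, hm⟩ := h
  have hp' : (0 : ℝ) < p := by exact_mod_cast hp
  filter_upwards [eventually_nhdsWithin_of_eventually_nhds (eventually_mul_mem_Ioo
    (show (m : ℝ) - 1 < t * p by linarith) (show t * (p : ℝ) < m + 1 by linarith)),
    self_mem_nhdsWithin] with s hs (hst : t < s)
  rw [Int.fract_eq_iff]
  exact ⟨by nlinarith, by nlinarith [hs.2], m, by linarith⟩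

theorem fract_eq_zero {p : ℤ} {t : ℝ} (h : IsIntTime p t) : Int.fract (t * (p : ℝ)) = 0 := by
  obtain ⟨m, hm⟩ := h
  rw [hm, Int.fract_intCast]

theorem eventually_nhds_of_sides {P : ℝ → Prop} {t : ℝ} (hl : ∀ᶠ s in 𝓝[<] t, P s) (h : P t)
    (hr : ∀ᶠ s in 𝓝[>] t, P s) : ∀ᶠ s in 𝓝 t, P s := by
  rw [← nhdsNE_sup_pure, Filter.eventually_sup, Filter.eventually_pure,
    punctured_nhds_eq_nhdsWithin_sup_nhdsWithin, Filter.eventually_sup]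
  exact ⟨⟨hl, hr⟩, h⟩

variable (T) in
/-- The path which runs through the squares `c` with velocity `p + q i`. -/
noncomputable def codedPath (p q : ℤ) (c : ℝ → ι) (t : ℝ) : T.Surface :=
  T.point (c t) ⟨Int.fract (t * p), Int.fract (t * q)⟩

/-- Right continuity of `c` matches the fractional parts: at a crossing the point sits on the left
or bottom edge of the square being entered, and the gluing identifies it with the opposite edge of
the square being left. -/
theorem IsCoding.isStraightAt_codedPath {p q : ℤ} {c : ℝ → ι} (h : T.IsCoding p q c)
    (hc : ∀ t ∈ Set.Ioo (0 : ℝ) 1, ∀ i j, JumpsAt c t i j → c t = j) (hp : 0 < p) (hq : 0 < q)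
    {t : ℝ} (ht : t ∈ Set.Ioo (0 : ℝ) 1) :
    T.IsStraightAt (T.codedPath p q c) ⟨p, q⟩ t := by
  have hp' : (0 : ℝ) < p := by exact_mod_cast hp
  have hq' : (0 : ℝ) < q := by exact_mod_cast hq
  by_cases htp : IsIntTime p t
  · have htq := h.avoids t ht htp
    obtain ⟨i, hi⟩ := h.right t ht htp
    have hct := hc t ht _ _ hi
    have hqf := eventually_fract_eq htq
    refine ⟨i, ⟨1, Int.fract (t * q)⟩, Or.inl ⟨?_, eventually_nhds_of_sides ?_ ?_ ?_⟩⟩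
    · rw [Complex.mem_reProdIm]
      exact ⟨by norm_num, fract_mem_Ioo htq⟩
    · filter_upwards [hi.1, eventually_fract_lt hp htp,
        eventually_nhdsWithin_of_eventually_nhds hqf, self_mem_nhdsWithin]
        with s h1 h2 h3 (hst : s < t)
      rw [codedPath, unfoldRight, if_pos (by simp; nlinarith), h1, h2, h3]
      congr 1
      apply Complex.ext <;> simp
    · rw [codedPath, unfoldRight, if_pos (by simp), hct, fract_eq_zero htp,
        T.point_eq_point_right i (by simp)]
      congr 1
      apply Complex.ext <;> simp
    · filter_upwards [hi.2, eventually_fract_gt hp htp,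
        eventually_nhdsWithin_of_eventually_nhds hqf, self_mem_nhdsWithin]
        with s h1 h2 h3 (hst : t < s)
      rw [codedPath, unfoldRight, if_neg (by simp; nlinarith), h1, h2, h3]
      congr 1
      apply Complex.ext <;> simp
  by_cases htq : IsIntTime q t
  · obtain ⟨i, -, hi⟩ := h.up t ht htq
    have hct := hc t ht _ _ hi
    have hpf := eventually_fract_eq htp
    refine ⟨i, ⟨Int.fract (t * p), 1⟩, Or.inr ⟨?_, eventually_nhds_of_sides ?_ ?_ ?_⟩⟩
    · rw [Complex.mem_reProdIm]
      exact ⟨fract_mem_Ioo htp, by norm_num⟩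
    · filter_upwards [hi.1, eventually_fract_lt hq htq,
        eventually_nhdsWithin_of_eventually_nhds hpf, self_mem_nhdsWithin]
        with s h1 h2 h3 (hst : s < t)
      rw [codedPath, unfoldUp, if_pos (by simp; nlinarith), h1, h2, h3]
      congr 1
      apply Complex.ext <;> simp
    · rw [codedPath, unfoldUp, if_pos (by simp), hct, fract_eq_zero htq,
        T.point_eq_point_up i (by simp)]
      congr 1
      apply Complex.ext <;> simp
    · filter_upwards [hi.2, eventually_fract_gt hq htq,
        eventually_nhdsWithin_of_eventually_nhds hpf, self_mem_nhdsWithin]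
        with s h1 h2 h3 (hst : t < s)
      rw [codedPath, unfoldUp, if_neg (by simp; nlinarith), h1, h2, h3]
      congr 1
      apply Complex.ext <;> simp
  · have hpf := eventually_fract_eq htp
    have hqf := eventually_fract_eq htq
    have hp1 := fract_mem_Ioo htp
    have hq1 := fract_mem_Ioo htq
    refine ⟨c t, ⟨Int.fract (t * p), Int.fract (t * q)⟩, Or.inl ⟨?_, ?_⟩⟩
    · rw [Complex.mem_reProdIm]
      exact ⟨⟨hp1.1, by simp only; linarith [hp1.2]⟩, hq1⟩
    · filter_upwards [h.eventually_eq hc ht htp htq, hpf, hqf] with s h1 h2 h3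
      have hlt := Int.fract_lt_one (s * (p : ℝ))
      rw [h2] at hlt
      rw [codedPath, unfoldRight, if_pos (by simpa using hlt.le), h1, h2, h3]
      congr 1
      apply Complex.ext <;> simp

theorem IsCoding.codedPath_notMem_slitInterior {p q : ℤ} {c : ℝ → ι} (h : T.IsCoding p q c)
    (hc : ∀ t ∈ Set.Ioo (0 : ℝ) 1, ∀ i j, JumpsAt c t i j → c t = j)
    {t : ℝ} (ht : t ∈ Set.Ioo (0 : ℝ) 1) : T.codedPath p q c t ∉ T.slitInterior := by
  intro hmem
  have hs := T.onSlit_of_mem_slitInterior hmem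
  rw [codedPath, T.point_eq_of_mem _ ⟨Int.fract_nonneg _, (Int.fract_lt_one _).le⟩
    ⟨Int.fract_nonneg _, (Int.fract_lt_one _).le⟩] at hs
  obtain ⟨-, ⟨h1, -⟩ | ⟨h0, hslit⟩⟩ := hs
  · exact (Int.fract_lt_one (t * (q : ℝ))).ne (congrArg Subtype.val h1)
  -- Fractional parts never equal 1, so the slit can only be met along the bottom edge of the square
  -- just entered.
  · have h0' : Int.fract (t * (q : ℝ)) = 0 := congrArg Subtype.val h0
    obtain ⟨m, hm⟩ := Int.fract_eq_zero_iff.1 h0'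
    obtain ⟨i, hi, hj⟩ := h.up t ht ⟨m, hm.symm⟩
    rw [hc t ht _ _ hj, Equiv.symm_apply_apply] at hslit
    exact hi hslit

theorem IsCoding.exists_isSaddleConnection [Nonempty ι] {p q : ℤ} {c : ℝ → ι}
    (h : T.IsCoding p q c) (hp : 0 < p) (hq : 0 < q) :
    ∃ γ, T.IsSaddleConnection γ ⟨p, q⟩ ∧ ∀ t ∈ Set.Ioo (0 : ℝ) 1, γ t ∉ T.slitInterior := by
  obtain ⟨d, hd, hdc⟩ := h.exists_rightContinuous
  have hp' : (0 : ℝ) < p := by exact_mod_cast hp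
  have hq' : (0 : ℝ) < q := by exact_mod_cast hq
  have hp1 : (1 : ℝ) ≤ p := by exact_mod_cast hp
  have hq1 : (1 : ℝ) ≤ q := by exact_mod_cast hq
  -- Within time `δ = 1 / (p + q)` of either end no edge is crossed, so the segment stays in one
  -- square there.
  obtain ⟨δ, hδ, hδ1, hδp, hδq⟩ : ∃ δ : ℝ, 0 < δ ∧ δ < 1 ∧ δ * p < 1 ∧ δ * q < 1 := by
    have hpos : (0 : ℝ) < p + q := by positivity
    refine ⟨(p + q : ℝ)⁻¹, by positivity, inv_lt_one_of_one_lt₀ (by linarith), ?_, ?_⟩ <;>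
    · rw [inv_mul_lt_iff₀ hpos]
      linarith
  have hfirst : ∀ s ∈ Set.Ioo 0 δ, d s = d (δ / 2) := by
    intro s hs
    refine hd.eq_of_forall_not_isIntTime hdc Set.ordConnected_Ioo
      (fun x hx => ⟨hx.1, hx.2.trans hδ1⟩) (fun x hx => ?_) hs ⟨by linarith, by linarith⟩
    exact ⟨not_isIntTime_of_mem (m := 0) (by push_cast; nlinarith [hx.1])
        (by push_cast; nlinarith [hx.2]),
      not_isIntTime_of_mem (m := 0) (by push_cast; nlinarith [hx.1])
        (by push_cast; nlinarith [hx.2])⟩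
  have hlast : ∀ s ∈ Set.Ioo (1 - δ) 1, d s = d (1 - δ / 2) := by
    intro s hs
    refine hd.eq_of_forall_not_isIntTime hdc Set.ordConnected_Ioo
      (fun x hx => ⟨by linarith [hx.1], hx.2⟩) (fun x hx => ?_) hs ⟨by linarith, by linarith⟩
    exact ⟨not_isIntTime_of_mem (m := p - 1) (by push_cast; nlinarith [hx.1])
        (by push_cast; nlinarith [hx.2]),
      not_isIntTime_of_mem (m := q - 1) (by push_cast; nlinarith [hx.1])
        (by push_cast; nlinarith [hx.2])⟩
  -- The coding is uncontrolled at times 0 and 1, so the ends are prescribed: the lower left corner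
  -- of the first square and the upper right corner of the last.
  let γ : ℝ → T.Surface := fun t =>
    if t ≤ 0 then T.point (d (δ / 2)) 0 else
      if 1 ≤ t then T.point (d (1 - δ / 2)) ⟨1, 1⟩ else T.codedPath p q d t
  have hγ : ∀ t ∈ Set.Ioo (0 : ℝ) 1, γ t = T.codedPath p q d t := fun t ht => by
    simp only [γ, if_neg (not_le.2 ht.1), if_neg (not_le.2 ht.2)]
  have hγ0 : γ 0 = T.point (d (δ / 2)) 0 := if_pos le_rfl
  have hγ1 : γ 1 = T.point (d (1 - δ / 2)) ⟨1, 1⟩ := by simp [γ]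
  have hstraight : ∀ t ∈ Set.Ioo (0 : ℝ) 1, T.IsStraightAt γ ⟨p, q⟩ t := by
    intro t ht
    have hev : ∀ᶠ s in 𝓝 t, γ s = T.codedPath p q d s := by
      filter_upwards [Ioo_mem_nhds ht.1 ht.2] with s hs using hγ s hs
    obtain ⟨i, w, ⟨hw, hs⟩ | ⟨hw, hs⟩⟩ := hd.isStraightAt_codedPath hdc hp hq ht
    · exact ⟨i, w, Or.inl ⟨hw, by filter_upwards [hev, hs] with s h1 h2 using h1.trans h2⟩⟩
    · exact ⟨i, w, Or.inr ⟨hw, by filter_upwards [hev, hs] with s h1 h2 using h1.trans h2⟩⟩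
  refine ⟨γ, ⟨?_, ?_, ?_, ?_, hstraight⟩, fun t ht => ?_⟩
  · intro h0
    exact hp'.ne' (congrArg Complex.re h0)
  · intro t ht
    rcases ht.1.eq_or_lt with rfl | h0
    · have hcont : Continuous fun s : ℝ => T.point (d (δ / 2)) ((s : ℂ) * ⟨p, q⟩) :=
        (T.continuous_point _).comp (by fun_prop)
      refine hcont.continuousWithinAt.congr_of_eventuallyEq ?_ (by simp [hγ0])
      filter_upwards [self_mem_nhdsWithin, nhdsWithin_le_nhds (Iio_mem_nhds hδ)]
        with s hs (hsδ : s < δ)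
      rcases hs.1.eq_or_lt with rfl | hs0
      · simp [hγ0]
      · rw [hγ s ⟨hs0, hsδ.trans hδ1⟩, codedPath, hfirst s ⟨hs0, hsδ⟩]
        rw [Int.fract_eq_self.2 ⟨by positivity, by nlinarith⟩,
          Int.fract_eq_self.2 ⟨by positivity, by nlinarith⟩]
        congr 1
        apply Complex.ext <;> simp
    rcases ht.2.eq_or_lt with rfl | h1
    · have hcont : Continuous fun s : ℝ =>
          T.point (d (1 - δ / 2)) (⟨1, 1⟩ + ((s - 1 : ℝ) : ℂ) * ⟨p, q⟩) :=
        (T.continuous_point _).comp (by fun_prop)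
      refine hcont.continuousWithinAt.congr_of_eventuallyEq ?_ (by simp [hγ1])
      filter_upwards [self_mem_nhdsWithin,
        nhdsWithin_le_nhds (Ioi_mem_nhds (show 1 - δ < 1 by linarith))] with s hs (hsδ : 1 - δ < s)
      rcases hs.2.eq_or_lt with rfl | hs1
      · simp [hγ1]
      · have hfr : ∀ k : ℤ, (0 : ℝ) < k → δ * k < 1 →
            Int.fract (s * (k : ℝ)) = 1 + (s - 1) * k := by
          intro k hk hδk
          rw [Int.fract_eq_iff]
          exact ⟨by nlinarith, by nlinarith, k - 1, by push_cast; ring⟩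
        rw [hγ s ⟨by linarith, hs1⟩, codedPath, hlast s ⟨hsδ, hs1⟩, hfr p hp' hδp, hfr q hq' hδq]
        congr 1
        apply Complex.ext <;> simp
    · exact (hstraight t ⟨h0, h1⟩).continuousAt.continuousWithinAt
  · exact ⟨d (δ / 2), 0, by simp, by simp, hγ0⟩
  · exact ⟨d (1 - δ / 2), ⟨1, 1⟩, by simp, by simp, hγ1⟩
  · rw [hγ t ht]
    exact hd.codedPath_notMem_slitInterior hdc ht

end SlitSquareTiling

/-! ### The rank -/

open SlitSquareTiling

theorem isVerticalAfterRotation_iff {θ : ℝ} {v : ℂ} :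
    IsVerticalAfterRotation θ v ↔ Real.cos θ * v.re = Real.sin θ * v.im := by
  rw [IsVerticalAfterRotation, Complex.mul_re, Complex.exp_ofReal_mul_I_re,
    Complex.exp_ofReal_mul_I_im, sub_eq_zero]

theorem mainTheorem5 (n : ℕ) (hn : 1 ≤ n) :
    ((n + 2 : ℕ) : ℕ∞) ≤ cantorBendixsonRank (staircaseSurface n).saddleDirections := by
  have hpi := Real.pi_pos
  have hcos : ∀ {θ : ℝ}, θ ∈ Set.Ico 0 Real.pi → θ ≠ Real.pi / 2 → Real.cos θ ≠ 0 := by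
    intro θ hθ hne
    rcases lt_or_gt_of_ne hne with h | h
    · exact (Real.cos_pos_of_mem_Ioo ⟨by linarith [hθ.1], h⟩).ne'
    · exact (Real.cos_neg_of_pi_div_two_lt_of_lt h (by linarith [hθ.2])).ne
  have hus : ∀ i, (staircaseSurface n).up i ∈ (staircaseSurface n).slits →
      i ∈ (staircaseSurface n).slits := fun i hi =>
    (staircaseUp n).injective (Eq.trans (Set.mem_singleton_iff.1 hi) (staircaseUp_zero n).symm)
  refine isStaircaseSlopes.le_cantorBendixsonRank n (fun θ hθ => hθ.1) ?_ ?_ ?_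
  -- The slit is horizontal, hence vertical after rotation by `π / 2`.
  · exact ⟨⟨by linarith, by linarith⟩,
      Or.inr ⟨⟨0, rfl⟩, isVerticalAfterRotation_iff.2 (by simp)⟩⟩
  · rintro θ ⟨hθ, ⟨γ, v, hγ, hv, hslit⟩ | ⟨-, hv⟩⟩ hne
    · have hcosθ := hcos hθ hne
      rw [isVerticalAfterRotation_iff] at hv
      have him : v.im ≠ 0 := by
        intro him
        rw [him, mul_zero] at hv
        exact hγ.holonomy_ne_zero
          (Complex.ext ((mul_eq_zero.1 hv).resolve_left hcosθ) him)
      have htan : Real.tan θ = v.re / v.im := by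
        rw [Real.tan_eq_sin_div_cos, div_eq_div_iff hcosθ him]
        linarith
      rw [htan]
      by_cases hre : v.re = 0
      · exact Or.inl (by rw [hre, zero_div])
      obtain ⟨p, q, hp, hq, hc⟩ := hγ.exists_isCoding
        (fun i => by
          change (staircaseRight n * staircaseRight n) i = i
          rw [staircaseRight_mul_self, Equiv.Perm.one_apply])
        (staircaseUp_apply_apply n)
        hus hslit hre him
      rw [hp] at hre
      rw [hq] at him
      exact Or.inr ⟨p, q, by exact_mod_cast hre, by exact_mod_cast him, by rw [hp, hq], hc⟩
    · rw [isVerticalAfterRotation_iff] at hv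
      exact (hcos hθ hne (by simpa using hv)).elim
  · rintro x (rfl | ⟨p, q, hp, hq, rfl, c, hc⟩) hx
    · exact (lt_irrefl _ hx).elim
    have hp' : (0 : ℝ) < ((|p| : ℤ) : ℝ) := by exact_mod_cast abs_pos.2 hp
    have hq' : (0 : ℝ) < ((|q| : ℤ) : ℝ) := by exact_mod_cast abs_pos.2 hq
    -- As `x > 0`, both components of the holonomy may be taken positive.
    have habs : (p : ℝ) / q = ((|p| : ℤ) : ℝ) / ((|q| : ℤ) : ℝ) := by
      rw [Int.cast_abs, Int.cast_abs, ← abs_div, abs_of_pos hx]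
    rw [habs]
    obtain ⟨γ, hγ, hslit⟩ := hc.abs.exists_isSaddleConnection (abs_pos.2 hp) (abs_pos.2 hq)
    refine ⟨⟨Real.arctan_nonneg.2 (by positivity),
      (Real.arctan_lt_pi_div_two _).trans (by linarith)⟩, Or.inl ⟨γ, _, hγ, ?_, hslit⟩⟩
    rw [isVerticalAfterRotation_iff, ← Real.tan_mul_cos (Real.cos_arctan_pos _).ne',
      Real.tan_arctan]
    field_simp
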